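/- Let $G$ be a finite simple graph with maximum degree $\Delta(G)$. Then $G$ has a subgraph $F$ that is a linear forest (every component of $F$ is a path) and satisfies the following properties: (1) each component of $F$ is a path of length $2$, $3$, or $4$ (the length being the number of edges); (2) every component of the induced subgraph $G-V(F)$ is a single vertex or a single edge, and each vertex of $V(G)\setminus V(F)$ has degree at most $(\Delta(G)+1)/2$ in $G$; (3) for each $v\in V(G)\setminus V(F)$ and each neighbour $u\in N_G(v)\cap V(F)$, the degree of $u$ in $F$ equals $2$. -/

import Mathlib

open scoped Classical

namespace SimpleGraph

/-- `H` is a path of length `n`, i.e. a path with `n` edges and `n + 1` vertices. -/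
def IsPathOfLength {W : Type*} (H : SimpleGraph W) (n : ℕ) : Prop :=
  Nonempty (H ≃g pathGraph (n + 1))

/-- A linear forest: every component is a path (a single vertex is a path of length `0`). -/
def IsLinearForest {W : Type*} (H : SimpleGraph W) : Prop :=
  ∀ C : H.ConnectedComponent, ∃ n : ℕ, C.toSimpleGraph.IsPathOfLength n

/-- Every component of `H` is a single vertex or a single edge. -/
def IsolatedVerticesOrEdges {W : Type*} (H : SimpleGraph W) : Prop :=
  ∀ C : H.ConnectedComponent,
    Nonempty (C.toSimpleGraph ≃g completeGraph (Fin 1)) ∨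
      Nonempty (C.toSimpleGraph ≃g completeGraph (Fin 2))

end SimpleGraph

/-! Let H be the set of vertices of degree at least (Δ+2)/2. It is enough to cover H by
vertex-disjoint paths with at least two edges and cycles (`IsPacking`). Among such packings take one
with the largest support, then delete edges as long as it remains a packing and no vertex gets
uncovered. Edge-minimality breaks cycles and long paths into paths of length 2, 3 or 4. Maximality
of the support gives the rest: an uncovered path with two edges could be added, and an uncovered
neighbour of an end of a path could be attached to it.

The covering rests on a Hall-type criterion, `NoObstruction.coverable`: H can be covered if every
set S has at most 2|S| vertices of H outside S with at most one neighbour outside S ("low"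
vertices). For the vertices of large degree this holds by double counting the edges between S and
its low vertices (`noObstruction_of_degree`).

The criterion is proved by induction on |H|, then on the number of edges. If a nonempty S attains
equality, Hall's theorem gives each vertex of S two low vertices as leaves; the rest is covered by
induction, and what is adjacent to a leaf is attached to it (`coverable_of_tight`). If all
inequalities are strict, an edge with an end outside H can be deleted or leads to a pendant
configuration (`coverable_of_leaf`). Otherwise some edge joins two vertices of degree at least
three. If deleting it creates an obstruction S, then S misses equality by exactly one, and an end of
the edge is "special": it has a neighbour in S and exactly two outside. A special vertex v serves as
the one missing leaf. For a maximal such S, either the rest can be covered after attaching an outer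
neighbour of v, or the surroundings of v are forced to be a triangle or a path r p v q t r', and
both are handled directly (`CriticalSet.coverable`). -/

namespace PathPacking

open SimpleGraph

/-! ### Packings and their local modifications -/

section

variable {V : Type*}

lemma sup_edge_le {F G : SimpleGraph V} {a b : V} (hF : F ≤ G) (h : G.Adj a b) :
    F ⊔ edge a b ≤ G := by
  refine sup_le hF ?_
  intro x y hxy
  rw [edge_adj] at hxy
  rcases hxy.1 with ⟨rfl, rfl⟩ | ⟨rfl, rfl⟩
  · exact h
  · exact h.symm

lemma sup_edge_adj (F : SimpleGraph V) {a b : V} (h : a ≠ b) : (F ⊔ edge a b).Adj a b := by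
  simp [edge_adj, h]

lemma mem_support_of_le {F F' : SimpleGraph V} (h : F ≤ F') {v : V} (hv : v ∈ F.support) :
    v ∈ F'.support := by
  obtain ⟨w, hw⟩ := hv
  exact ⟨w, h hw⟩

variable [Fintype V]

/-- The neighbours of `v`, as a finset. -/
noncomputable def nbrs (G : SimpleGraph V) (v : V) : Finset V :=
  Finset.univ.filter fun w => G.Adj v w

@[simp] lemma mem_nbrs {G : SimpleGraph V} {v w : V} : w ∈ nbrs G v ↔ G.Adj v w := by
  simp [nbrs]

lemma nbrs_mono {F G : SimpleGraph V} (h : F ≤ G) (v : V) : nbrs F v ⊆ nbrs G v := by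
  intro w hw
  rw [mem_nbrs] at hw ⊢
  exact h hw

lemma nbrs_congr {F G : SimpleGraph V} {v : V} (h : ∀ w, F.Adj v w ↔ G.Adj v w) :
    nbrs F v = nbrs G v := by
  ext w
  simp [h w]

lemma nbrs_eq_empty_iff {F : SimpleGraph V} {v : V} : nbrs F v = ∅ ↔ v ∉ F.support := by
  simp [Finset.eq_empty_iff_forall_notMem, SimpleGraph.mem_support]

/-- Every vertex has degree at most two, and no component is a single edge: the components of `F`
are isolated vertices, paths with at least two edges, and cycles. -/
structure IsPacking (F : SimpleGraph V) : Prop where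
  card_le_two : ∀ v, (nbrs F v).card ≤ 2
  card_eq_two : ∀ a b, F.Adj a b → (nbrs F a).card = 2 ∨ (nbrs F b).card = 2

/-- `H` is covered by vertex-disjoint paths with at least two edges and cycles of `G`. -/
def Coverable (G : SimpleGraph V) (H : Finset V) : Prop :=
  ∃ F ≤ G, IsPacking F ∧ ∀ h ∈ H, h ∈ F.support

lemma isPacking_bot : IsPacking (⊥ : SimpleGraph V) where
  card_le_two v := by simp [nbrs]
  card_eq_two a b h := by simp at h

lemma Coverable.mono {G G' : SimpleGraph V} {H : Finset V} (hG : G ≤ G') (h : Coverable G H) :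
    Coverable G' H := by
  obtain ⟨F, hF, hP, hH⟩ := h
  exact ⟨F, hF.trans hG, hP, hH⟩

lemma nbrs_sup_edge_left (F : SimpleGraph V) {a b : V} (h : a ≠ b) :
    nbrs (F ⊔ edge a b) a = insert b (nbrs F a) := by
  ext w
  simp only [mem_nbrs, sup_adj, edge_adj, Finset.mem_insert]
  constructor
  · rintro (h' | ⟨⟨-, rfl⟩ | ⟨rfl, rfl⟩, h3⟩)
    · exact Or.inr h'
    · exact Or.inl rfl
    · exact absurd rfl h
  · rintro (rfl | h')
    · exact Or.inr ⟨Or.inl ⟨trivial, rfl⟩, h⟩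
    · exact Or.inl h'

lemma nbrs_sup_edge_right (F : SimpleGraph V) {a b : V} (h : a ≠ b) :
    nbrs (F ⊔ edge a b) b = insert a (nbrs F b) := by
  rw [edge_comm, nbrs_sup_edge_left F h.symm]

lemma nbrs_sup_edge_of_ne (F : SimpleGraph V) {a b x : V} (ha : x ≠ a) (hb : x ≠ b) :
    nbrs (F ⊔ edge a b) x = nbrs F x := by
  apply nbrs_congr
  intro w
  simp only [sup_adj, edge_adj]
  tauto

/-- Attaching an uncovered vertex to the end of a path. -/
lemma IsPacking.addPendant {F : SimpleGraph V} (hF : IsPacking F) {w u : V}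
    (hu : u ∉ F.support) (hw : (nbrs F w).card = 1) : IsPacking (F ⊔ edge w u) := by
  have hu' := nbrs_eq_empty_iff.2 hu
  have hne : w ≠ u := by
    rintro rfl
    simp [hu'] at hw
  have hnu : u ∉ nbrs F w := by
    intro h
    exact hu ⟨w, (mem_nbrs.1 h).symm⟩
  have h1 : (nbrs (F ⊔ edge w u) w).card = 2 := by
    rw [nbrs_sup_edge_left F hne, Finset.card_insert_of_notMem hnu, hw]
  have h2 : (nbrs (F ⊔ edge w u) u).card = 1 := by
    rw [nbrs_sup_edge_right F hne, hu']
    simp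
  have hle : ∀ v, (nbrs (F ⊔ edge w u) v).card ≤ 2 := by
    intro v
    by_cases hv : v = w
    · rw [hv, h1]
    by_cases hv' : v = u
    · rw [hv', h2]
      norm_num
    rw [nbrs_sup_edge_of_ne F hv hv']
    exact hF.card_le_two v
  refine ⟨hle, ?_⟩
  intro a b hab
  rw [sup_adj, edge_adj] at hab
  rcases hab with hab | ⟨⟨rfl, rfl⟩ | ⟨rfl, rfl⟩, -⟩
  · rcases hF.card_eq_two a b hab with h | h
    · left
      exact le_antisymm (hle a) (h ▸ Finset.card_le_card (nbrs_mono le_sup_left a))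
    · right
      exact le_antisymm (hle b) (h ▸ Finset.card_le_card (nbrs_mono le_sup_left b))
  · exact Or.inl h1
  · exact Or.inr h1

/-- Adding a path with two edges on uncovered vertices. -/
lemma IsPacking.addPath {F : SimpleGraph V} (hF : IsPacking F) {a b c : V} (hab : a ≠ b)
    (hbc : b ≠ c) (hac : a ≠ c) (ha : a ∉ F.support) (hb : b ∉ F.support) (hc : c ∉ F.support) :
    IsPacking (F ⊔ edge a b ⊔ edge b c) := by
  have ha' := nbrs_eq_empty_iff.2 ha
  have hb' := nbrs_eq_empty_iff.2 hb
  have hc' := nbrs_eq_empty_iff.2 hc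
  have h1 : (nbrs (F ⊔ edge a b ⊔ edge b c) b).card = 2 := by
    rw [nbrs_sup_edge_left _ hbc, nbrs_sup_edge_right _ hab, hb',
      Finset.card_insert_of_notMem (by simp [hac.symm])]
    simp
  have hold : ∀ v, v ≠ a → v ≠ b → v ≠ c → nbrs (F ⊔ edge a b ⊔ edge b c) v = nbrs F v := by
    intro v h1 h2 h3
    rw [nbrs_sup_edge_of_ne _ h2 h3, nbrs_sup_edge_of_ne _ h1 h2]
  constructor
  · intro v
    by_cases hva : v = a
    · subst hva
      rw [nbrs_sup_edge_of_ne _ hab hac, nbrs_sup_edge_left _ hab, ha']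
      simp
    by_cases hvb : v = b
    · rw [hvb, h1]
    by_cases hvc : v = c
    · subst hvc
      rw [nbrs_sup_edge_right _ hbc, nbrs_sup_edge_of_ne _ hac.symm hbc.symm, hc']
      simp
    rw [hold v hva hvb hvc]
    exact hF.card_le_two v
  · intro x y hxy
    rw [sup_adj, sup_adj, edge_adj, edge_adj] at hxy
    rcases hxy with (hxy | ⟨⟨rfl, rfl⟩ | ⟨rfl, rfl⟩, -⟩) | ⟨⟨rfl, rfl⟩ | ⟨rfl, rfl⟩, -⟩
    · have hx : x ∈ F.support := ⟨y, hxy⟩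
      have hy : y ∈ F.support := ⟨x, hxy.symm⟩
      rw [hold x (by rintro rfl; exact ha hx) (by rintro rfl; exact hb hx)
        (by rintro rfl; exact hc hx), hold y (by rintro rfl; exact ha hy)
        (by rintro rfl; exact hb hy) (by rintro rfl; exact hc hy)]
      exact hF.card_eq_two x y hxy
    · exact Or.inr h1
    · exact Or.inl h1
    · exact Or.inl h1
    · exact Or.inr h1

/-- Replacing an edge `p r` by a path from `v` to `p` and a path `q t r`, where `v` is the end of
a path and `q`, `t` are uncovered. -/
lemma IsPacking.swap {F : SimpleGraph V} (hF : IsPacking F) {p r v q t : V} (hpr : F.Adj p r)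
    (hv : (nbrs F v).card = 1) (hq : q ∉ F.support) (ht : t ∉ F.support) (hqt : q ≠ t)
    (hvp : v ≠ p) (hvr : v ≠ r) (hnvp : ¬ F.Adj v p) :
    IsPacking ((F.deleteEdges {s(p, r)}) ⊔ edge v p ⊔ edge q t ⊔ edge t r) := by
  set D := F.deleteEdges {s(p, r)} with hD
  have hDF : D ≤ F := F.deleteEdges_le _
  have hprne : p ≠ r := hpr.ne
  have hp : p ∈ F.support := ⟨r, hpr⟩
  have hr : r ∈ F.support := ⟨p, hpr.symm⟩
  have hvs : v ∈ F.support := by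
    by_contra h
    rw [nbrs_eq_empty_iff.2 h] at hv
    simp at hv
  have ne_of : ∀ {x y : V}, x ∈ F.support → y ∉ F.support → x ≠ y := by
    rintro x y hx hy rfl
    exact hy hx
  have hq' := nbrs_eq_empty_iff.2 hq
  have ht' := nbrs_eq_empty_iff.2 ht
  have hDp : nbrs D p = (nbrs F p).erase r := by
    ext w
    simp only [hD, mem_nbrs, deleteEdges_adj, Set.mem_singleton_iff, Sym2.eq_iff, Finset.mem_erase]
    constructor
    · rintro ⟨h1, h2⟩
      exact ⟨fun h => h2 (Or.inl ⟨trivial, h⟩), h1⟩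
    · rintro ⟨h1, h2⟩
      exact ⟨h2, by rintro (⟨-, h⟩ | ⟨h, -⟩); exacts [h1 h, hprne h]⟩
  have hDr : nbrs D r = (nbrs F r).erase p := by
    ext w
    simp only [hD, mem_nbrs, deleteEdges_adj, Set.mem_singleton_iff, Sym2.eq_iff, Finset.mem_erase]
    constructor
    · rintro ⟨h1, h2⟩
      exact ⟨fun h => h2 (Or.inr ⟨trivial, h⟩), h1⟩
    · rintro ⟨h1, h2⟩
      exact ⟨h2, by rintro (⟨h, -⟩ | ⟨-, h⟩); exacts [hprne h.symm, h1 h]⟩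
  have hDo : ∀ x, x ≠ p → x ≠ r → nbrs D x = nbrs F x := by
    intro x h1 h2
    apply nbrs_congr
    intro w
    simp [hD, deleteEdges_adj, h1, h2]
  have hvq := ne_of hvs hq
  have hvt := ne_of hvs ht
  have hpq := ne_of hp hq
  have hpt := ne_of hp ht
  have hrq := ne_of hr hq
  have hrt := ne_of hr ht
  set E := D ⊔ edge v p ⊔ edge q t ⊔ edge t r with hE
  -- Both `p` and `r` trade one edge for another, so only `v`, `q` and `t` change degree.
  have hEp : (nbrs E p).card = (nbrs F p).card := by
    rw [hE, nbrs_sup_edge_of_ne _ hpt hprne, nbrs_sup_edge_of_ne _ hpq hpt,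
      nbrs_sup_edge_right _ hvp, hDp, Finset.card_insert_of_notMem, Finset.card_erase_of_mem]
    · have : 0 < (nbrs F p).card := Finset.card_pos.2 ⟨r, mem_nbrs.2 hpr⟩
      omega
    · exact mem_nbrs.2 hpr
    · intro h
      exact hnvp (mem_nbrs.1 (Finset.mem_of_mem_erase h)).symm
  have hEr : (nbrs E r).card = (nbrs F r).card := by
    rw [hE, nbrs_sup_edge_right _ hrt.symm, nbrs_sup_edge_of_ne _ hrq hrt,
      nbrs_sup_edge_of_ne _ hvr.symm hprne.symm, hDr, Finset.card_insert_of_notMem,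
      Finset.card_erase_of_mem]
    · have : 0 < (nbrs F r).card := Finset.card_pos.2 ⟨p, mem_nbrs.2 hpr.symm⟩
      omega
    · exact mem_nbrs.2 hpr.symm
    · intro h
      exact ht ⟨r, (mem_nbrs.1 (Finset.mem_of_mem_erase h)).symm⟩
  have hEv : (nbrs E v).card = 2 := by
    rw [hE, nbrs_sup_edge_of_ne _ hvt hvr, nbrs_sup_edge_of_ne _ hvq hvt,
      nbrs_sup_edge_left _ hvp, hDo v hvp hvr, Finset.card_insert_of_notMem, hv]
    simpa using hnvp
  have hEq : (nbrs E q).card = 1 := by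
    rw [hE, nbrs_sup_edge_of_ne _ hqt hrq.symm, nbrs_sup_edge_left _ hqt,
      nbrs_sup_edge_of_ne _ hvq.symm hpq.symm, hDo q hpq.symm hrq.symm, hq']
    simp
  have hEt : (nbrs E t).card = 2 := by
    rw [hE, nbrs_sup_edge_left _ hrt.symm, nbrs_sup_edge_right _ hqt,
      nbrs_sup_edge_of_ne _ hvt.symm hpt.symm, hDo t hpt.symm hrt.symm, ht',
      Finset.card_insert_of_notMem]
    · simp
    · simpa using hrq
  have hEo : ∀ x, x ≠ p → x ≠ r → x ≠ v → x ≠ q → x ≠ t → nbrs E x = nbrs F x := by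
    intro x h1 h2 h3 h4 h5
    rw [hE, nbrs_sup_edge_of_ne _ h5 h2, nbrs_sup_edge_of_ne _ h4 h5,
      nbrs_sup_edge_of_ne _ h3 h1, hDo x h1 h2]
  have hcard : ∀ x, (nbrs F x).card = 2 → (nbrs E x).card = 2 := by
    intro x hx
    by_cases h1 : x = p
    · rw [h1, hEp, ← h1, hx]
    by_cases h2 : x = r
    · rw [h2, hEr, ← h2, hx]
    by_cases h3 : x = v
    · rw [h3, hEv]
    have hxs : x ∈ F.support := by
      by_contra h
      rw [nbrs_eq_empty_iff.2 h] at hx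
      simp at hx
    rw [hEo x h1 h2 h3 (ne_of hxs hq) (ne_of hxs ht), hx]
  constructor
  · intro x
    by_cases h1 : x = p
    · rw [h1, hEp]; exact hF.card_le_two p
    by_cases h2 : x = r
    · rw [h2, hEr]; exact hF.card_le_two r
    by_cases h3 : x = v
    · rw [h3, hEv]
    by_cases h4 : x = q
    · rw [h4, hEq]; norm_num
    by_cases h5 : x = t
    · rw [h5, hEt]
    rw [hEo x h1 h2 h3 h4 h5]
    exact hF.card_le_two x
  · intro x y hxy
    rw [hE, sup_adj, sup_adj, sup_adj, edge_adj, edge_adj, edge_adj] at hxy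
    rcases hxy with ((hxy | ⟨⟨rfl, rfl⟩ | ⟨rfl, rfl⟩, -⟩) | ⟨⟨rfl, rfl⟩ | ⟨rfl, rfl⟩, -⟩) |
      ⟨⟨rfl, rfl⟩ | ⟨rfl, rfl⟩, -⟩
    · exact (hF.card_eq_two x y (hDF hxy)).imp (hcard x) (hcard y)
    · exact Or.inl hEv
    · exact Or.inr hEv
    · exact Or.inr hEt
    · exact Or.inl hEt
    · exact Or.inl hEt
    · exact Or.inr hEt

end

/-! ### Stars from Hall's theorem, attachment to leaves, and the obstruction condition -/

section

variable {V : Type*}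

/-- The graph `G` with the vertices in `W` made isolated. -/
def avoid (G : SimpleGraph V) (W : Finset V) : SimpleGraph V where
  Adj a b := G.Adj a b ∧ a ∉ W ∧ b ∉ W
  symm := ⟨fun _ _ h => ⟨h.1.symm, h.2.2, h.2.1⟩⟩
  loopless := ⟨fun _ h => G.loopless.irrefl _ h.1⟩

lemma avoid_adj {G : SimpleGraph V} {W : Finset V} {a b : V} :
    (avoid G W).Adj a b ↔ G.Adj a b ∧ a ∉ W ∧ b ∉ W := Iff.rfl

lemma avoid_le (G : SimpleGraph V) (W : Finset V) : avoid G W ≤ G := fun _ _ h => h.1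

lemma notMem_support_of_le_avoid {F G : SimpleGraph V} {W : Finset V} (h : F ≤ avoid G W) {v : V}
    (hv : v ∈ W) : v ∉ F.support := by
  rintro ⟨w, hw⟩
  exact (h hw).2.1 hv

lemma not_avoid_adj {G : SimpleGraph V} {W : Finset V} : ∀ w ∈ W, ∀ x, ¬ (avoid G W).Adj x w :=
  fun _ hw _ h => h.2.2 hw

variable [Fintype V]

/-- Take a maximal packing above `F` in which every `y` keeps at most one neighbour in `S`. An
uncovered `z` could be attached to a `y` of degree one. A `y` of degree two already uses a neighbour
outside `S`, and its only such neighbour in `G` is `z`. -/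
lemma IsPacking.exists_attach {G F : SimpleGraph V} {S Y : Finset V} (hF : IsPacking F)
    (hFG : F ≤ G) (hY : ∀ y ∈ Y, y ∈ F.support) (hYG : ∀ y ∈ Y, (nbrs G y \ S).card ≤ 1)
    (hYF : ∀ y ∈ Y, (nbrs F y ∩ S).card ≤ 1) :
    ∃ F' ≤ G, IsPacking F' ∧ F ≤ F' ∧ ∀ y ∈ Y, ∀ z, z ∉ S → G.Adj y z → z ∈ F'.support := by
  obtain ⟨F', hle, ⟨⟨h1, h2, h3⟩, hmax⟩⟩ := (Set.toFinite {F' : SimpleGraph V |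
    F' ≤ G ∧ IsPacking F' ∧ ∀ y ∈ Y, (nbrs F' y ∩ S).card ≤ 1}).exists_le_maximal
      (a := F) ⟨hFG, hF, hYF⟩
  refine ⟨F', h1, h2, hle, ?_⟩
  intro y hy z hzS hyz
  by_contra hz
  have hz' := nbrs_eq_empty_iff.2 hz
  have hys : y ∈ F'.support := mem_support_of_le hle (hY y hy)
  have hpos : 0 < (nbrs F' y).card := by
    obtain ⟨w, hw⟩ := hys
    exact Finset.card_pos.2 ⟨w, mem_nbrs.2 hw⟩
  have hcard := h2.card_le_two y
  rcases (by omega : (nbrs F' y).card = 1 ∨ (nbrs F' y).card = 2) with hc | hc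
  · have hmem : F' ⊔ edge y z ∈ {F' : SimpleGraph V |
        F' ≤ G ∧ IsPacking F' ∧ ∀ y ∈ Y, (nbrs F' y ∩ S).card ≤ 1} := by
      refine ⟨sup_edge_le h1 hyz, h2.addPendant hz hc, ?_⟩
      intro x hx
      by_cases hxy : x = y
      · subst hxy
        rw [nbrs_sup_edge_left _ hyz.ne, Finset.insert_inter_of_notMem hzS]
        exact h3 x hx
      by_cases hxz : x = z
      · subst hxz
        rw [nbrs_sup_edge_right _ hyz.ne, hz']
        exact (Finset.card_le_card Finset.inter_subset_left).trans (by simp)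
      rw [nbrs_sup_edge_of_ne _ hxy hxz]
      exact h3 x hx
    exact hz ⟨y, (hmax hmem le_sup_left (sup_edge_adj F' hyz.ne)).symm⟩
  · have hsum := Finset.card_sdiff_add_card_inter (nbrs F' y) S
    have h4 := h3 y hy
    obtain ⟨w, hw⟩ : (nbrs F' y \ S).Nonempty := Finset.card_pos.1 (by omega)
    have hwz : w = z := Finset.card_le_one.1 (hYG y hy) w
      (Finset.sdiff_subset_sdiff (nbrs_mono h1 y) subset_rfl hw) z (by simp [hyz, hzS])
    subst hwz
    rw [Finset.mem_sdiff, mem_nbrs] at hw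
    exact hz ⟨y, hw.1.symm⟩

/-- The fibres of `f` are pairs, so the edges from `y` to `f y` form paths with two edges centred in
`S`. Their leaves have degree one and remain available for later extension. -/
lemma IsPacking.exists_stars {G F : SimpleGraph V} {S Y : Finset V} (hF : IsPacking F)
    (hFG : F ≤ G) (hSY : Disjoint S Y) {f : V → V} (hfS : ∀ y ∈ Y, f y ∈ S)
    (hfG : ∀ y ∈ Y, G.Adj y (f y)) (hf : ∀ s ∈ S, (Y.filter fun y => f y = s).card = 2)
    (hS : ∀ x ∈ S, x ∉ F.support) (hY : ∀ x ∈ Y, x ∉ F.support) :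
    ∃ F' ≤ G, IsPacking F' ∧ F ≤ F' ∧ (∀ x, x ∉ S → x ∉ Y → nbrs F' x = nbrs F x) ∧
      (∀ y ∈ Y, ∃ s ∈ S, nbrs F' y = {s}) ∧ ∀ s ∈ S, s ∈ F'.support := by
  set D : SimpleGraph V := SimpleGraph.fromRel fun a b => a ∈ Y ∧ b = f a with hD
  have hDadj : ∀ a b, D.Adj a b ↔ (a ∈ Y ∧ b = f a) ∨ (b ∈ Y ∧ a = f b) := by
    intro a b
    rw [hD, SimpleGraph.fromRel_adj]
    refine ⟨fun h => h.2, fun h => ⟨?_, h⟩⟩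
    rintro rfl
    have : a ∈ Y ∧ a = f a := by simpa using h
    exact Finset.disjoint_left.1 hSY (this.2 ▸ hfS a this.1) this.1
  have hDY : ∀ y ∈ Y, nbrs (F ⊔ D) y = {f y} := by
    intro y hy
    ext w
    rw [mem_nbrs, sup_adj, hDadj, Finset.mem_singleton]
    constructor
    · rintro (h | h | h)
      · exact absurd ⟨w, h⟩ (hY y hy)
      · exact h.2
      · exact absurd hy (Finset.disjoint_left.1 hSY (h.2 ▸ hfS w h.1))
    · intro h
      exact Or.inr (Or.inl ⟨hy, h⟩)
  have hDS : ∀ s ∈ S, nbrs (F ⊔ D) s = Y.filter fun y => f y = s := by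
    intro s hs
    ext w
    rw [mem_nbrs, sup_adj, hDadj, Finset.mem_filter]
    constructor
    · rintro (h | h | h)
      · exact absurd ⟨w, h⟩ (hS s hs)
      · exact absurd h.1 (Finset.disjoint_left.1 hSY hs)
      · exact ⟨h.1, h.2.symm⟩
    · intro h
      exact Or.inr (Or.inr ⟨h.1, h.2.symm⟩)
  have hDo : ∀ x, x ∉ S → x ∉ Y → nbrs (F ⊔ D) x = nbrs F x := by
    intro x hxS hxY
    apply nbrs_congr
    intro w
    rw [sup_adj, hDadj]
    constructor
    · rintro (h | h | h)
      · exact h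
      · exact absurd h.1 hxY
      · exact absurd (h.2 ▸ hfS w h.1) hxS
    · exact Or.inl
  refine ⟨F ⊔ D, sup_le hFG ?_, ⟨?_, ?_⟩, le_sup_left, hDo,
    fun y hy => ⟨f y, hfS y hy, hDY y hy⟩, ?_⟩
  · intro a b hab
    rcases (hDadj a b).1 hab with ⟨h1, rfl⟩ | ⟨h1, rfl⟩
    · exact hfG a h1
    · exact (hfG b h1).symm
  · intro x
    by_cases hxS : x ∈ S
    · rw [hDS x hxS, hf x hxS]
    by_cases hxY : x ∈ Y
    · rw [hDY x hxY]
      simp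
    rw [hDo x hxS hxY]
    exact hF.card_le_two x
  · intro a b hab
    rcases hab with hab | hab
    · have ha : a ∈ F.support := ⟨b, hab⟩
      have hb : b ∈ F.support := ⟨a, hab.symm⟩
      rw [hDo a (fun h => hS a h ha) (fun h => hY a h ha),
        hDo b (fun h => hS b h hb) (fun h => hY b h hb)]
      exact hF.card_eq_two a b hab
    · rcases (hDadj a b).1 hab with ⟨h1, rfl⟩ | ⟨h1, rfl⟩
      · right
        rw [hDS _ (hfS a h1), hf _ (hfS a h1)]
      · left
        rw [hDS _ (hfS b h1), hf _ (hfS b h1)]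
  · intro s hs
    by_contra h
    have h1 := nbrs_eq_empty_iff.2 h
    have h2 := hf s hs
    rw [← hDS s hs, h1] at h2
    simp at h2

/-- Hall's theorem for assigning exactly two elements of `Y` to each element of `S`. -/
lemma exists_two_to_one {G : SimpleGraph V} {S Y : Finset V} (hcard : Y.card = 2 * S.card)
    (hall : ∀ T ⊆ Y, T.card ≤ 2 * (S.filter fun s => ∃ y ∈ T, G.Adj y s).card) :
    ∃ f : V → V, (∀ y ∈ Y, f y ∈ S) ∧ (∀ y ∈ Y, G.Adj y (f y)) ∧
      ∀ s ∈ S, (Y.filter fun y => f y = s).card = 2 := by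
  -- Two copies of each `s` turn a two-to-one assignment into an injective one.
  let t : Y → Finset (V × Bool) := fun y => (S.filter fun s => G.Adj y s) ×ˢ Finset.univ
  have key : ∀ T : Finset Y, T.card ≤ (T.biUnion t).card := by
    intro T
    have h1 := hall (T.map (Function.Embedding.subtype _)) (by
      intro x hx
      simp only [Finset.mem_map, Function.Embedding.subtype_apply] at hx
      obtain ⟨a, -, rfl⟩ := hx
      exact a.2)
    rw [Finset.card_map] at h1
    refine h1.trans (le_of_eq ?_)
    have h2 : T.biUnion t = (S.filter fun s => ∃ y ∈ T.map (Function.Embedding.subtype _),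
        G.Adj y s) ×ˢ (Finset.univ : Finset Bool) := by
      ext ⟨s, b⟩
      simp only [t, Finset.mem_biUnion, Finset.mem_product, Finset.mem_filter, Finset.mem_univ,
        and_true, Finset.mem_map, Function.Embedding.subtype_apply]
      constructor
      · rintro ⟨a, ha, hs, hG⟩
        exact ⟨hs, a, ⟨a, ha, rfl⟩, hG⟩
      · rintro ⟨hs, y, ⟨a, ha, rfl⟩, hG⟩
        exact ⟨a, ha, hs, hG⟩
    rw [h2, Finset.card_product]
    simp [mul_comm]
  obtain ⟨g, hg, hgt⟩ := (Finset.all_card_le_biUnion_card_iff_exists_injective t).1 key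
  have hgt' : ∀ y, (g y).1 ∈ S ∧ G.Adj y (g y).1 := by
    intro y
    have := hgt y
    simpa [t] using this
  let f : V → V := fun y => if h : y ∈ Y then (g ⟨y, h⟩).1 else y
  have hfy : ∀ y (h : y ∈ Y), f y = (g ⟨y, h⟩).1 := fun y h => by simp [f, h]
  have hfS : ∀ y ∈ Y, f y ∈ S := fun y h => by
    rw [hfy y h]
    exact (hgt' _).1
  have hle : ∀ s ∈ S, (Y.filter fun y => f y = s).card ≤ 2 := by
    intro s hs
    have : (Y.filter fun y => f y = s).card ≤ (Finset.univ : Finset Bool).card := by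
      refine Finset.card_le_card_of_injOn (fun y => if h : y ∈ Y then (g ⟨y, h⟩).2 else true)
        (fun _ _ => Finset.mem_coe.2 (Finset.mem_univ _)) ?_
      intro a ha b hb hab
      simp only [Finset.coe_filter, Set.mem_ofPred_eq] at ha hb
      simp only [ha.1, hb.1, dif_pos] at hab
      have h1 : (g ⟨a, ha.1⟩).1 = (g ⟨b, hb.1⟩).1 := by
        rw [← hfy, ← hfy, ha.2, hb.2]
      have := hg (Prod.ext h1 hab)
      simpa using this
    simpa using this
  -- Fibres of size at most two whose sizes add up to 2|S| all have size exactly two.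
  have hsum : ∑ s ∈ S, (Y.filter fun y => f y = s).card = ∑ s ∈ S, 2 := by
    rw [← Finset.card_eq_sum_card_fiberwise (s := Y) (t := S) (f := f) (fun y hy => hfS y hy),
      hcard]
    simp [mul_comm]
  refine ⟨f, hfS, fun y hy => ?_, ?_⟩
  · rw [hfy y hy]
    exact (hgt' ⟨y, hy⟩).2
  · exact (Finset.sum_eq_sum_iff_of_le hle).1 hsum

/-- The vertices of `H` that have at most one neighbour outside `S`. -/
noncomputable def low (G : SimpleGraph V) (H S : Finset V) : Finset V :=
  H.filter fun y => y ∉ S ∧ (nbrs G y \ S).card ≤ 1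

lemma mem_low {G : SimpleGraph V} {H S : Finset V} {y : V} :
    y ∈ low G H S ↔ y ∈ H ∧ y ∉ S ∧ (nbrs G y \ S).card ≤ 1 := by
  simp [low]

lemma disjoint_low (G : SimpleGraph V) (H S : Finset V) : Disjoint S (low G H S) := by
  rw [Finset.disjoint_left]
  intro x hx hx'
  exact (mem_low.1 hx').2.1 hx

/-- No set `S` has more than `2 * |S|` vertices of `H` with at most one neighbour outside `S`. -/
def NoObstruction (G : SimpleGraph V) (H : Finset V) : Prop :=
  ∀ S : Finset V, (low G H S).card ≤ 2 * S.card

end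

/-! ### Induction steps: tight sets, deletable edges, leaves -/

section

variable {V : Type*} [Fintype V]

/-- Removed vertices are kept as isolated ones so that the vertex type stays fixed. Dropping them
from `S` changes no outer neighbourhood, so only sets avoiding them need testing. -/
lemma noObstruction_of_disjoint {G : SimpleGraph V} {H W : Finset V}
    (hW : ∀ w ∈ W, ∀ x, ¬ G.Adj x w)
    (h : ∀ S : Finset V, Disjoint S W → (low G H S).card ≤ 2 * S.card) : NoObstruction G H := by
  intro S
  have h1 : low G H S ⊆ low G H (S \ W) := by
    intro y hy
    rw [mem_low] at hy ⊢
    refine ⟨hy.1, fun h => hy.2.1 (Finset.mem_sdiff.1 h).1, ?_⟩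
    refine (Finset.card_le_card ?_).trans hy.2.2
    intro x hx
    simp only [Finset.mem_sdiff, mem_nbrs, not_and, not_not] at hx ⊢
    exact ⟨hx.1, fun hxS => hW x (hx.2 hxS) y hx.1⟩
  have h2 := h (S \ W) Finset.sdiff_disjoint
  have h3 := Finset.card_le_card h1
  have h4 : (S \ W).card ≤ S.card := Finset.card_le_card Finset.sdiff_subset
  omega

lemma two_le_degree {G : SimpleGraph V} {H : Finset V} (h : NoObstruction G H) {y : V}
    (hy : y ∈ H) : 2 ≤ (nbrs G y).card := by
  by_contra hlt
  have h1 := h ∅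
  have h2 : y ∈ low G H ∅ := mem_low.2 ⟨hy, by simp, by simp; omega⟩
  have h3 := Finset.card_pos.2 ⟨y, h2⟩
  simp at h1
  rw [h1] at h2
  simp at h2

/-- The part of `H` outside `W` without neighbours in `Y`. -/
noncomputable def remote (G : SimpleGraph V) (H W Y : Finset V) : Finset V :=
  H.filter fun h => h ∉ W ∧ ∀ y ∈ Y, ¬ G.Adj y h

lemma mem_remote {G : SimpleGraph V} {H W Y : Finset V} {h : V} :
    h ∈ remote G H W Y ↔ h ∈ H ∧ h ∉ W ∧ ∀ y ∈ Y, ¬ G.Adj y h := by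
  simp [remote]

/-- Attaching the neighbours of `low G H S` to the stars centred in `S`. -/
lemma coverable_of_attach {G F : SimpleGraph V} {H S : Finset V} (hF : IsPacking F) (hFG : F ≤ G)
    (hS : ∀ s ∈ S, s ∈ F.support) (hY : ∀ y ∈ low G H S, ∃ s ∈ S, nbrs F y = {s})
    (hH : ∀ h ∈ H, h ∈ F.support ∨ ∃ y ∈ low G H S, G.Adj y h) : Coverable G H := by
  obtain ⟨F', hF'G, hF', hFF', hatt⟩ := hF.exists_attach hFG (S := S) (Y := low G H S)
    (fun y hy => by
      obtain ⟨s, -, hs⟩ := hY y hy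
      exact ⟨s, mem_nbrs.1 (by rw [hs]; simp)⟩)
    (fun y hy => (mem_low.1 hy).2.2)
    (fun y hy => by
      obtain ⟨s, -, h⟩ := hY y hy
      rw [h]
      exact (Finset.card_le_card Finset.inter_subset_left).trans (by simp))
  refine ⟨F', hF'G, hF', fun h hh => ?_⟩
  by_cases hhS : h ∈ S
  · exact mem_support_of_le hFF' (hS h hhS)
  rcases hH h hh with h1 | ⟨y, hy, hyh⟩
  · exact mem_support_of_le hFF' h1
  · exact hatt y hy h hhS hyh

/-- The induction step when some nonempty set `S` attains equality. -/
lemma coverable_of_tight {G : SimpleGraph V} {H S : Finset V} (hno : NoObstruction G H)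
    (hS : S.Nonempty) (hcard : (low G H S).card = 2 * S.card)
    (IH : ∀ (G' : SimpleGraph V) (H' : Finset V), H'.card < H.card → NoObstruction G' H' →
      Coverable G' H') : Coverable G H := by
  set Y := low G H S with hY
  have hSY : Disjoint S Y := disjoint_low G H S
  have hYH : Y ⊆ H := fun y hy => (mem_low.1 hy).1
  set H' := remote G H (S ∪ Y) Y with hH'
  have hlt : H'.card < H.card := by
    apply Finset.card_lt_card
    refine ⟨fun x hx => (mem_remote.1 hx).1, fun hsub => ?_⟩
    obtain ⟨y, hy⟩ : Y.Nonempty := by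
      rw [← Finset.card_pos, hcard]
      have := hS.card_pos
      omega
    exact (mem_remote.1 (hsub (hYH hy))).2.1 (Finset.mem_union_right _ hy)
  have hno' : NoObstruction (avoid G (S ∪ Y)) H' := by
    refine noObstruction_of_disjoint not_avoid_adj ?_
    intro T hT
    rw [Finset.disjoint_union_right] at hT
    -- A vertex of the remainder has no neighbour in `Y`, so all its neighbours outside `S ∪ T`
    -- survive. Subtracting |Y| = 2|S| from the bound for `S ∪ T` leaves the one for `T`.
    have hsub : low (avoid G (S ∪ Y)) H' T ∪ Y ⊆ low G H (S ∪ T) := by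
      intro y hy
      rw [Finset.mem_union] at hy
      rcases hy with hy | hy
      · obtain ⟨h1, h2, h3⟩ := mem_low.1 hy
        obtain ⟨h4, h5, h6⟩ := mem_remote.1 h1
        refine mem_low.2 ⟨h4, by simp at h5 ⊢; tauto, (Finset.card_le_card ?_).trans h3⟩
        intro x hx
        simp only [Finset.mem_sdiff, mem_nbrs, Finset.mem_union, not_or, avoid_adj] at hx h5 ⊢
        exact ⟨⟨hx.1, h5, hx.2.1, fun h => h6 x h hx.1.symm⟩, hx.2.2⟩
      · obtain ⟨h1, h2, h3⟩ := mem_low.1 hy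
        refine mem_low.2 ⟨h1, ?_, (Finset.card_le_card ?_).trans h3⟩
        · simp only [Finset.mem_union, not_or]
          exact ⟨h2, fun h => Finset.disjoint_left.1 hT.2 h hy⟩
        · exact Finset.sdiff_subset_sdiff subset_rfl Finset.subset_union_left
    have h1 := Finset.card_le_card hsub
    rw [Finset.card_union_of_disjoint, hcard] at h1
    · have h2 := hno (S ∪ T)
      rw [Finset.card_union_of_disjoint hT.1.symm] at h2
      omega
    · rw [Finset.disjoint_left]
      intro x hx hxY
      exact (mem_remote.1 (mem_low.1 hx).1).2.1 (Finset.mem_union_right _ hxY)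
  obtain ⟨F₁, hF₁G, hF₁, hF₁H⟩ := IH _ _ hlt hno'
  -- Hall's condition: the vertices of `T` are low already for the set of their neighbours in `S`.
  obtain ⟨f, hfS, hfG, hf⟩ := exists_two_to_one (G := G) hcard (by
    intro T hT
    refine (Finset.card_le_card ?_).trans (hno _)
    intro y hy
    obtain ⟨h1, h2, h3⟩ := mem_low.1 (hT hy)
    refine mem_low.2 ⟨h1, fun h => h2 (Finset.mem_filter.1 h).1,
      (Finset.card_le_card ?_).trans h3⟩
    intro x hx
    simp only [Finset.mem_sdiff, mem_nbrs, Finset.mem_filter, not_and, not_exists] at hx ⊢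
    exact ⟨hx.1, fun h => hx.2 h y hy hx.1⟩)
  obtain ⟨F₂, hF₂G, hF₂, hF₁₂, -, hF₂Y, hF₂S⟩ := hF₁.exists_stars
    (hF₁G.trans (avoid_le _ _)) hSY hfS hfG hf
    (fun x hx => notMem_support_of_le_avoid hF₁G (Finset.mem_union_left _ hx))
    (fun x hx => notMem_support_of_le_avoid hF₁G (Finset.mem_union_right _ hx))
  refine coverable_of_attach hF₂ hF₂G hF₂S hF₂Y ?_
  intro h hh
  by_cases hhS : h ∈ S
  · exact Or.inl (hF₂S h hhS)
  by_cases hhY : h ∈ Y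
  · obtain ⟨s, -, hs⟩ := hF₂Y h hhY
    exact Or.inl ⟨s, mem_nbrs.1 (by rw [hs]; simp)⟩
  by_cases hadj : ∃ y ∈ Y, G.Adj y h
  · exact Or.inr hadj
  · push Not at hadj
    exact Or.inl (mem_support_of_le hF₁₂ (hF₁H h (mem_remote.2 ⟨hh, by simp [hhS, hhY], hadj⟩)))

/-- Deleting an edge with an end outside `H`. -/
lemma noObstruction_deleteEdge {G : SimpleGraph V} {H : Finset V} (hno : NoObstruction G H)
    (hstrict : ∀ S : Finset V, S.Nonempty → (low G H S).card < 2 * S.card) {a b : V}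
    (ha : a ∉ H) (hb : b ∉ H ∨ 3 ≤ (nbrs G b).card) :
    NoObstruction (G.deleteEdges {s(a, b)}) H := by
  have hnb : ∀ y, y ≠ a → y ≠ b → nbrs (G.deleteEdges {s(a, b)}) y = nbrs G y := by
    intro y h1 h2
    apply nbrs_congr
    intro w
    simp [deleteEdges_adj, h1, h2]
  intro S
  -- Since `a ∉ H`, only `b` can become low, and strictness absorbs one new vertex. For empty `S`,
  -- where strictness says nothing, the degree of `b` is used instead.
  have hsub : low (G.deleteEdges {s(a, b)}) H S ⊆ insert b (low G H S) := by
    intro y hy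
    rw [Finset.mem_insert]
    by_cases hyb : y = b
    · exact Or.inl hyb
    · right
      obtain ⟨h1, h2, h3⟩ := mem_low.1 hy
      rw [hnb y (by rintro rfl; exact ha h1) hyb] at h3
      exact mem_low.2 ⟨h1, h2, h3⟩
  rcases S.eq_empty_or_nonempty with rfl | hS
  · have h0 : low (G.deleteEdges {s(a, b)}) H ∅ = ∅ := by
      rw [Finset.eq_empty_iff_forall_notMem]
      intro y hy
      rcases Finset.mem_insert.1 (hsub hy) with rfl | h
      · obtain ⟨h1, -, h3⟩ := mem_low.1 hy
        have h4 : (nbrs G y).erase a ⊆ nbrs (G.deleteEdges {s(a, y)}) y \ ∅ := by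
          intro x hx
          simp only [Finset.mem_erase, mem_nbrs] at hx
          simp only [Finset.sdiff_empty, mem_nbrs, deleteEdges_adj, Set.mem_singleton_iff,
            Sym2.eq_iff]
          refine ⟨hx.2, ?_⟩
          rintro (⟨rfl, -⟩ | ⟨-, rfl⟩)
          · exact ha h1
          · exact hx.1 rfl
        have h5 := Finset.card_le_card h4
        have h6 := Finset.pred_card_le_card_erase (a := a) (s := nbrs G y)
        rcases hb with hb | hb
        · exact hb h1
        · omega
      · have := hno ∅
        simp at this
        rw [this] at h
        simp at h
    rw [h0]
    simp
  · have h1 := Finset.card_le_card hsub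
    have h2 := Finset.card_insert_le b (low G H S)
    have h3 := hstrict S hS
    omega

/-- Deleting a path `v b c` where `v` is a leaf and `b` has degree two. -/
lemma coverable_of_leaf {G : SimpleGraph V} {H : Finset V}
    (hstrict : ∀ S : Finset V, S.Nonempty → (low G H S).card < 2 * S.card) {v b c : V}
    (hv : v ∉ H) (hb : b ∈ H) (hvc : v ≠ c) (hNb : nbrs G b = {v, c}) (hNv : nbrs G v = {b})
    (IH : ∀ (G' : SimpleGraph V) (H' : Finset V), H'.card < H.card → NoObstruction G' H' →
      Coverable G' H') : Coverable G H := by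
  have hbv : G.Adj b v := by rw [← mem_nbrs, hNb]; simp
  have hbc : G.Adj b c := by rw [← mem_nbrs, hNb]; simp
  set W : Finset V := {v, b, c} with hW
  have hlt : (H \ W).card < H.card := by
    apply Finset.card_lt_card
    refine ⟨Finset.sdiff_subset, fun h => ?_⟩
    have := Finset.mem_sdiff.1 (h hb)
    simp [hW] at this
  have hno' : NoObstruction (avoid G W) (H \ W) := by
    refine noObstruction_of_disjoint not_avoid_adj ?_
    intro T hT
    have hTb : b ∉ T := fun h => Finset.disjoint_left.1 hT h (by simp [hW])
    have hTc : c ∉ T := fun h => Finset.disjoint_left.1 hT h (by simp [hW])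
    -- Strictness is applied to `T ∪ {c}`: there `b` has only `v` outside and counts as an
    -- additional low vertex, so |low| + 1 < 2|T| + 2 for the smaller graph.
    have hsub : insert b (low (avoid G W) (H \ W) T) ⊆ low G H (insert c T) := by
      intro y hy
      rw [Finset.mem_insert] at hy
      rcases hy with rfl | hy
      · refine mem_low.2 ⟨hb, by simp [hbc.ne, hTb], ?_⟩
        rw [hNb]
        refine (Finset.card_le_card (t := {v}) ?_).trans (by simp)
        intro x hx
        simp only [Finset.mem_sdiff, Finset.mem_insert, Finset.mem_singleton, not_or] at hx ⊢
        tauto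
      · obtain ⟨h1, h2, h3⟩ := mem_low.1 hy
        simp only [Finset.mem_sdiff, hW, Finset.mem_insert, Finset.mem_singleton, not_or] at h1
        refine mem_low.2 ⟨h1.1, by simp [h2, h1.2], (Finset.card_le_card ?_).trans h3⟩
        intro x hx
        simp only [Finset.mem_sdiff, mem_nbrs, Finset.mem_insert, not_or, avoid_adj] at hx ⊢
        refine ⟨⟨hx.1, by simp [hW, h1.2], ?_⟩, hx.2.2⟩
        simp only [hW, Finset.mem_insert, Finset.mem_singleton, not_or]
        refine ⟨?_, ?_, hx.2.1⟩
        · rintro rfl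
          have := mem_nbrs.2 hx.1.symm
          rw [hNv, Finset.mem_singleton] at this
          exact h1.2.2.1 this
        · rintro rfl
          have := mem_nbrs.2 hx.1.symm
          rw [hNb, Finset.mem_insert, Finset.mem_singleton] at this
          tauto
    have h1 := Finset.card_le_card hsub
    rw [Finset.card_insert_of_notMem] at h1
    · have h2 := hstrict (insert c T) (Finset.insert_nonempty _ _)
      rw [Finset.card_insert_of_notMem hTc] at h2
      omega
    · intro h
      have := (mem_low.1 h).1
      simp [hW] at this
  obtain ⟨F, hFG, hF, hFH⟩ := IH _ _ hlt hno'
  refine ⟨F ⊔ edge v b ⊔ edge b c,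
    sup_edge_le (sup_edge_le (hFG.trans (avoid_le _ _)) hbv.symm) hbc,
    hF.addPath hbv.ne.symm hbc.ne hvc (notMem_support_of_le_avoid hFG (by simp [hW]))
      (notMem_support_of_le_avoid hFG (by simp [hW]))
      (notMem_support_of_le_avoid hFG (by simp [hW])), ?_⟩
  intro h hh
  by_cases hhW : h ∈ W
  · simp only [hW, Finset.mem_insert, Finset.mem_singleton] at hhW
    rcases hhW with rfl | rfl | rfl
    · exact absurd hh hv
    · exact ⟨c, sup_edge_adj _ hbc.ne⟩
    · exact ⟨b, (sup_edge_adj _ hbc.ne).symm⟩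
  · exact mem_support_of_le (le_sup_left.trans le_sup_left)
      (hFH h (Finset.mem_sdiff.2 ⟨hh, hhW⟩))

end

/-! ### Critical sets and special vertices -/

section

variable {V : Type*} [Fintype V]

/-- A vertex with a neighbour in `S` and exactly two neighbours outside `S`. -/
structure Special (G : SimpleGraph V) (S : Finset V) (v : V) : Prop where
  notMem : v ∉ S
  card_eq : (nbrs G v \ S).card = 2
  exists_adj : ∃ s ∈ S, G.Adj v s

/-- A set missing equality in `NoObstruction` by one, with no larger such set that has a special
vertex, in a graph where no nonempty set attains equality. -/
structure CriticalSet (G : SimpleGraph V) (H S : Finset V) : Prop where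
  noObstruction : NoObstruction G H
  strict : ∀ T : Finset V, T.Nonempty → (low G H T).card < 2 * T.card
  mem_of_adj : ∀ a b, G.Adj a b → a ∈ H
  card_eq : (low G H S).card + 1 = 2 * S.card
  maximal : ∀ T, S ⊂ T → (low G H T).card + 1 = 2 * T.card → ∀ w, ¬ Special G T w

namespace CriticalSet

variable {G : SimpleGraph V} {H S : Finset V} {v : V}

lemma notMem_low (hv : Special G S v) : v ∉ low G H S := by
  intro h
  have h1 := (mem_low.1 h).2.2
  have h2 := hv.card_eq
  omega

/-- The special vertex is the leaf missing from |Y| = 2|S| − 1. In Hall's condition a set containing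
`v` has a nonempty neighbourhood in `S`, where the strict inequality leaves room for `v`. The larger
graph `G'` allows `F` to use an auxiliary edge. -/
lemma exists_stars (hC : CriticalSet G H S) (hv : Special G S v) {F G' : SimpleGraph V}
    (hF : IsPacking F) (hGG' : G ≤ G') (hFG : F ≤ G') (hFW : ∀ x ∈ insert v (S ∪ low G H S), x ∉ F.support) :
    ∃ F' ≤ G', IsPacking F' ∧ F ≤ F' ∧
      (∀ x, x ∉ insert v (S ∪ low G H S) → nbrs F' x = nbrs F x) ∧
      (∀ y ∈ insert v (low G H S), ∃ s ∈ S, nbrs F' y = {s}) ∧ ∀ s ∈ S, s ∈ F'.support := by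
  have hvY : v ∉ low G H S := notMem_low hv
  have hcard : (insert v (low G H S)).card = 2 * S.card := by
    rw [Finset.card_insert_of_notMem hvY, hC.card_eq]
  obtain ⟨f, hfS, hfG, hf⟩ := exists_two_to_one (G := G) hcard (by
    intro T hT
    have h1 : (T.erase v) ⊆ low G H (S.filter fun s => ∃ y ∈ T, G.Adj y s) := by
      intro y hy
      rw [Finset.mem_erase] at hy
      obtain ⟨h1, h2, h3⟩ := mem_low.1 ((Finset.mem_insert.1 (hT hy.2)).resolve_left hy.1)
      refine mem_low.2 ⟨h1, fun h => h2 (Finset.mem_filter.1 h).1,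
        (Finset.card_le_card ?_).trans h3⟩
      intro x hx
      simp only [Finset.mem_sdiff, mem_nbrs, Finset.mem_filter, not_and, not_exists] at hx ⊢
      exact ⟨hx.1, fun h => hx.2 h y hy.2 hx.1⟩
    have h2 := Finset.card_le_card h1
    by_cases hvT : v ∈ T
    · rw [Finset.card_erase_of_mem hvT] at h2
      obtain ⟨s, hs, hvs⟩ := hv.exists_adj
      have h3 := hC.strict (S.filter fun s => ∃ y ∈ T, G.Adj y s)
        ⟨s, Finset.mem_filter.2 ⟨hs, v, hvT, hvs⟩⟩
      omega
    · rw [Finset.erase_eq_of_notMem hvT] at h2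
      exact h2.trans (hC.noObstruction _))
  have hdis : Disjoint S (insert v (low G H S)) := by
    rw [Finset.disjoint_insert_right]
    exact ⟨hv.notMem, disjoint_low G H S⟩
  obtain ⟨F', h1, h2, h3, h4, h5, h6⟩ := hF.exists_stars hFG hdis hfS
    (fun y hy => hGG' (hfG y hy)) hf
    (fun x hx => hFW x (by simp [hx])) (fun x hx => hFW x (by
      rw [Finset.mem_insert] at hx ⊢
      exact hx.imp_right (Finset.mem_union_right _)))
  refine ⟨F', h1, h2, h3, fun x hx => ?_, h5, h6⟩
  simp only [Finset.mem_insert, Finset.mem_union, not_or] at hx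
  exact h4 x hx.2.1 (by simp [hx])

/-- If `T` misses equality by one, maximality forbids `v` to be special for `T`, so `v` has at most
one neighbour outside `T` and is itself low; erasing it gains one more unit. That unit later pays
for an exceptional vertex. -/
lemma card_erase_low (hC : CriticalSet G H S) (hv : Special G S v) {T : Finset V} (hST : S ⊂ T)
    (hvT : v ∉ T) : ((low G H T).erase v).card + 2 ≤ 2 * T.card := by
  have h1 := hC.strict T (by
    obtain ⟨x, hx, -⟩ := Finset.exists_of_ssubset hST
    exact ⟨x, hx⟩)
  by_cases h2 : (low G H T).card + 1 = 2 * T.card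
  · obtain ⟨s, hs, hvs⟩ := hv.exists_adj
    have h3 : (nbrs G v \ T).card ≠ 2 := fun h =>
      hC.maximal T hST h2 v ⟨hvT, h, s, hST.1 hs, hvs⟩
    have h4 := Finset.card_le_card (Finset.sdiff_subset_sdiff (subset_refl (nbrs G v)) hST.1)
    rw [hv.card_eq] at h4
    have h5 : v ∈ low G H T := mem_low.2 ⟨hC.mem_of_adj _ _ hvs, hvT, by omega⟩
    rw [Finset.card_erase_of_mem h5]
    have := Finset.card_pos.2 ⟨v, h5⟩
    omega
  · have := Finset.card_erase_le (s := low G H T) (a := v)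
    omega

/-- A criterion for the remaining graph to have no obstruction, with one exceptional vertex `q`. -/
lemma noObstruction_rest (hC : CriticalSet G H S) (hv : Special G S v) {G₁ : SimpleGraph V}
    {H₁ W : Finset V} {q : V} (hW : insert v (S ∪ low G H S) ⊆ W)
    (hiso : ∀ w ∈ W, ∀ x, ¬ G₁.Adj x w) (hH₁ : H₁ ⊆ remote G H W (low G H S))
    (hq : q ∈ H₁ → 2 ≤ (nbrs G₁ q).card)
    (hT : ∀ T, Disjoint T W → (low G₁ H₁ T).card ≤ 2 * T.card ∨
      ∀ y ∈ H₁, y ≠ q → (nbrs G y \ (S ∪ T)).card ≤ (nbrs G₁ y \ T).card) :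
    NoObstruction G₁ H₁ := by
  refine noObstruction_of_disjoint hiso ?_
  intro T hTW
  rcases hT T hTW with h | hT
  · exact h
  have hSW : S ⊆ W := fun x hx => hW (by simp [hx])
  have hYW : low G H S ⊆ W := fun x hx => hW (by simp [hx])
  have hvW : v ∈ W := hW (by simp)
  have hlow : ∀ y ∈ low G₁ H₁ T, y ≠ q → y ∈ low G H (S ∪ T) ∧ y ∉ W := by
    intro y hy hyq
    obtain ⟨h1, h2, h3⟩ := mem_low.1 hy
    obtain ⟨h4, h5, -⟩ := mem_remote.1 (hH₁ h1)
    refine ⟨mem_low.2 ⟨h4, ?_, (hT y h1 hyq).trans h3⟩, h5⟩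
    simp only [Finset.mem_union, not_or]
    exact ⟨fun h => h5 (hSW h), h2⟩
  rcases T.eq_empty_or_nonempty with rfl | hTne
  · have : low G₁ H₁ ∅ = ∅ := by
      rw [Finset.eq_empty_iff_forall_notMem]
      intro y hy
      by_cases hyq : y = q
      · subst hyq
        obtain ⟨h1, -, h3⟩ := mem_low.1 hy
        have := hq h1
        simp at h3
        omega
      · obtain ⟨h1, h2⟩ := hlow y hy hyq
        rw [Finset.union_empty] at h1
        exact h2 (hYW h1)
    rw [this]
    simp
  · have hdis : Disjoint S T := by
      rw [Finset.disjoint_right]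
      exact fun x hx hxS => Finset.disjoint_left.1 hTW hx (hSW hxS)
    have hss : S ⊂ S ∪ T := by
      refine ⟨Finset.subset_union_left, fun h => ?_⟩
      obtain ⟨x, hx⟩ := hTne
      exact Finset.disjoint_right.1 hdis hx (h (Finset.mem_union_right _ hx))
    have hvT : v ∉ S ∪ T := by
      simp only [Finset.mem_union, not_or]
      exact ⟨hv.notMem, fun h => Finset.disjoint_left.1 hTW h hvW⟩
    have h1 := hC.card_erase_low hv hss hvT
    -- With |Y| = 2|S| − 1 this gives (|low| − 1) + (2|S| − 1) ≤ 2(|S| + |T|) − 2, which is the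
    -- required bound even when `q` is low.
    have hsub : (low G₁ H₁ T).erase q ∪ low G H S ⊆ (low G H (S ∪ T)).erase v := by
      intro y hy
      rw [Finset.mem_union, Finset.mem_erase] at hy
      rcases hy with ⟨hyq, hy⟩ | hy
      · obtain ⟨h2, h3⟩ := hlow y hy hyq
        exact Finset.mem_erase.2 ⟨by rintro rfl; exact h3 hvW, h2⟩
      · refine Finset.mem_erase.2 ⟨by rintro rfl; exact notMem_low hv hy, ?_⟩
        obtain ⟨h2, h3, h4⟩ := mem_low.1 hy
        refine mem_low.2 ⟨h2, ?_, (Finset.card_le_card ?_).trans h4⟩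
        · simp only [Finset.mem_union, not_or]
          exact ⟨h3, fun h => Finset.disjoint_left.1 hTW h (hYW hy)⟩
        · exact Finset.sdiff_subset_sdiff subset_rfl Finset.subset_union_left
    have h2 := Finset.card_le_card hsub
    rw [Finset.card_union_of_disjoint] at h2
    · rw [Finset.card_union_of_disjoint hdis] at h1
      have h3 := Finset.pred_card_le_card_erase (a := q) (s := low G₁ H₁ T)
      have h4 := hC.card_eq
      omega
    · rw [Finset.disjoint_left]
      intro x hx hxY
      rw [Finset.mem_erase] at hx
      exact (hlow x hx.2 hx.1).2 (hYW hxY)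

lemma card_lt (hv : Special G S v) (hC : CriticalSet G H S) {H₁ W : Finset V} (hvW : v ∈ W)
    (hH₁ : H₁ ⊆ remote G H W (low G H S)) : H₁.card < H.card := by
  apply Finset.card_lt_card
  refine ⟨fun x hx => (mem_remote.1 (hH₁ hx)).1, fun hsub => ?_⟩
  obtain ⟨s, -, hvs⟩ := hv.exists_adj
  exact (mem_remote.1 (hH₁ (hsub (hC.mem_of_adj _ _ hvs)))).2.1 hvW

/-- One of the two outer neighbours of a special vertex is attached to the star of the special
vertex; this needs the other one to have enough further neighbours. -/
lemma coverable_of_neighbor (hC : CriticalSet G H S) (hv : Special G S v) {p q : V}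
    (hN : nbrs G v \ S = {p, q})
    (hq : q ∈ low G H S ∨ (∃ y ∈ low G H S, G.Adj y q) ∨ 3 ≤ (nbrs G q \ S).card)
    (IH : ∀ (G' : SimpleGraph V) (H' : Finset V), H'.card < H.card → NoObstruction G' H' →
      Coverable G' H') : Coverable G H := by
  set Y := low G H S with hY
  set W := insert v (S ∪ Y) with hW
  -- No cover of `p` is demanded from the induction: if `p` stays uncovered, it is attached to `v`,
  -- a leaf of its star.
  set H₁ := (remote G H W Y).erase p with hH₁
  have hH₁r : H₁ ⊆ remote G H W Y := Finset.erase_subset _ _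
  have hvW : v ∈ W := by simp [hW]
  have hvp : G.Adj v p := mem_nbrs.1 (Finset.mem_sdiff.1 (hN.symm ▸ (by simp) : p ∈ nbrs G v \ S)).1
  have hpS : p ∉ S := (Finset.mem_sdiff.1 (hN.symm ▸ (by simp) : p ∈ nbrs G v \ S)).2
  have hmemN : ∀ x, x ∉ S → G.Adj v x → x = p ∨ x = q := by
    intro x h1 h2
    have : x ∈ nbrs G v \ S := by simp [h1, h2]
    rw [hN] at this
    simpa using this
  have hno : NoObstruction (avoid G W) H₁ := by
    refine hC.noObstruction_rest hv (q := q) subset_rfl not_avoid_adj hH₁r ?_ ?_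
    · intro hqH
      obtain ⟨h1, h2, h3⟩ := mem_remote.1 (hH₁r hqH)
      have h4 : 3 ≤ (nbrs G q \ S).card := by
        rcases hq with h | ⟨y, hy, h⟩ | h
        · exact absurd (by simp [hW, h]) h2
        · exact absurd h (h3 y hy)
        · exact h
      -- Outside `S`, the only neighbour that `q` can lose is `v`, so at least two remain.
      have h5 : (nbrs G q \ S).erase v ⊆ nbrs (avoid G W) q := by
        intro x hx
        simp only [Finset.mem_erase, Finset.mem_sdiff, mem_nbrs] at hx
        refine mem_nbrs.2 ⟨hx.2.1, h2, ?_⟩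
        simp only [hW, Finset.mem_insert, Finset.mem_union, not_or]
        exact ⟨hx.1, hx.2.2, fun h => h3 x h hx.2.1.symm⟩
      have h6 := Finset.card_le_card h5
      have h7 := Finset.pred_card_le_card_erase (a := v) (s := nbrs G q \ S)
      omega
    · intro T hTW
      right
      intro y hy hyq
      obtain ⟨h1, h2, h3⟩ := mem_remote.1 (hH₁r hy)
      have hyp : y ≠ p := (Finset.mem_erase.1 hy).1
      apply Finset.card_le_card
      intro x hx
      simp only [Finset.mem_sdiff, mem_nbrs, Finset.mem_union, not_or] at hx
      refine Finset.mem_sdiff.2 ⟨mem_nbrs.2 ⟨hx.1, h2, ?_⟩, hx.2.2⟩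
      simp only [hW, Finset.mem_insert, Finset.mem_union, not_or]
      refine ⟨?_, hx.2.1, fun h => h3 x h hx.1.symm⟩
      rintro rfl
      rcases hmemN y (fun h => h2 (by simp [hW, h])) hx.1.symm with h | h
      · exact hyp h
      · exact hyq h
  obtain ⟨F₁, hF₁G, hF₁, hF₁H⟩ := IH _ _ (card_lt hv hC hvW hH₁r) hno
  obtain ⟨F₂, hF₂G, hF₂, hF₁₂, hF₂o, hF₂Y, hF₂S⟩ := hC.exists_stars hv hF₁ le_rfl
    (hF₁G.trans (avoid_le _ _)) (fun x hx => notMem_support_of_le_avoid hF₁G hx)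
  have hYs : ∀ y ∈ insert v Y, y ∈ F₂.support := by
    intro y hy
    obtain ⟨s, -, hs⟩ := hF₂Y y hy
    exact ⟨s, mem_nbrs.1 (by rw [hs]; simp)⟩
  have hcov : ∀ h ∈ H, h ≠ p → h ∈ F₂.support ∨ ∃ y ∈ Y, G.Adj y h := by
    intro h hh hhp
    by_cases hhW : h ∈ W
    · left
      simp only [hW, Finset.mem_insert, Finset.mem_union] at hhW
      rcases hhW with rfl | hhW | hhW
      · exact hYs _ (by simp)
      · exact hF₂S h hhW
      · exact hYs h (by simp [hhW])
    · by_cases hadj : ∃ y ∈ Y, G.Adj y h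
      · exact Or.inr hadj
      · push Not at hadj
        exact Or.inl (mem_support_of_le hF₁₂
          (hF₁H h (Finset.mem_erase.2 ⟨hhp, mem_remote.2 ⟨hh, hhW, hadj⟩⟩)))
  by_cases hp : p ∈ F₂.support
  · refine coverable_of_attach hF₂ hF₂G hF₂S (fun y hy => hF₂Y y (Finset.mem_insert_of_mem hy)) ?_
    intro h hh
    by_cases hhp : h = p
    · exact Or.inl (hhp ▸ hp)
    · exact hcov h hh hhp
  · obtain ⟨s, hs, hsv⟩ := hF₂Y v (by simp)
    refine coverable_of_attach (hF₂.addPendant hp (by rw [hsv]; simp)) (sup_edge_le hF₂G hvp)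
      (fun s hs => mem_support_of_le le_sup_left (hF₂S s hs)) ?_ ?_
    · intro y hy
      obtain ⟨s, hs, hsy⟩ := hF₂Y y (Finset.mem_insert_of_mem hy)
      refine ⟨s, hs, ?_⟩
      rw [nbrs_sup_edge_of_ne, hsy]
      · rintro rfl
        exact notMem_low hv hy
      · rintro rfl
        exact hp (hYs y (Finset.mem_insert_of_mem hy))
    · intro h hh
      by_cases hhp : h = p
      · subst hhp
        exact Or.inl ⟨v, (sup_edge_adj _ hvp.ne).symm⟩
      · exact (hcov h hh hhp).imp_left (mem_support_of_le le_sup_left)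

end CriticalSet

end

/-! ### Triangle and path configurations at a special vertex -/

section

variable {V : Type*} [Fintype V]

namespace CriticalSet

variable {G : SimpleGraph V} {H S : Finset V} {v : V}

/-- A path `v q t` is appended to the star of the special vertex `v`. -/
lemma coverable_of_chain (hC : CriticalSet G H S) (hv : Special G S v) {q t : V} {W : Finset V}
    (hW : W = insert t (insert q (insert v (S ∪ low G H S))))
    (hq : q ∉ insert v (S ∪ low G H S)) (ht : t ∉ insert v (S ∪ low G H S))
    (hvq : G.Adj v q) (hqt : G.Adj q t) {F₁ : SimpleGraph V} (hF₁ : IsPacking F₁)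
    (hF₁G : F₁ ≤ avoid G W) (hF₁H : ∀ h ∈ remote G H W (low G H S), h ∈ F₁.support) :
    Coverable G H := by
  obtain ⟨F₂, hF₂G, hF₂, hF₁₂, hF₂o, hF₂Y, hF₂S⟩ := hC.exists_stars hv hF₁ le_rfl
    (hF₁G.trans (avoid_le _ _)) (fun x hx => notMem_support_of_le_avoid hF₁G (by
      rw [hW]
      exact Finset.mem_insert_of_mem (Finset.mem_insert_of_mem hx)))
  have hqF : q ∉ F₂.support := by
    rw [← nbrs_eq_empty_iff, hF₂o q hq, nbrs_eq_empty_iff]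
    exact notMem_support_of_le_avoid hF₁G (by simp [hW])
  have htF : t ∉ F₂.support := by
    rw [← nbrs_eq_empty_iff, hF₂o t ht, nbrs_eq_empty_iff]
    exact notMem_support_of_le_avoid hF₁G (by simp [hW])
  have hvt : v ≠ t := by
    rintro rfl
    simp at ht
  obtain ⟨s₀, hs₀, hvs₀⟩ := hF₂Y v (by simp)
  have hF₃ := hF₂.addPendant hqF (w := v) (by rw [hvs₀]; simp)
  have hF₄ := hF₃.addPendant (w := q) (u := t)
    (by rw [← nbrs_eq_empty_iff, nbrs_sup_edge_of_ne _ hvt.symm hqt.ne.symm, nbrs_eq_empty_iff]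
        exact htF)
    (by rw [nbrs_sup_edge_right _ hvq.ne, nbrs_eq_empty_iff.2 hqF]; simp)
  refine coverable_of_attach hF₄ (sup_edge_le (sup_edge_le hF₂G hvq) hqt)
    (fun s hs => mem_support_of_le (le_sup_left.trans le_sup_left) (hF₂S s hs)) ?_ ?_
  · intro y hy
    obtain ⟨s, hs, hsy⟩ := hF₂Y y (Finset.mem_insert_of_mem hy)
    refine ⟨s, hs, ?_⟩
    have hyv : y ≠ v := by
      rintro rfl
      exact notMem_low hv hy
    have hyq : y ≠ q := by
      rintro rfl
      exact hq (by simp [hy])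
    have hyt : y ≠ t := by
      rintro rfl
      exact ht (by simp [hy])
    rw [nbrs_sup_edge_of_ne _ hyq hyt, nbrs_sup_edge_of_ne _ hyv hyq, hsy]
  · intro h hh
    by_cases hhW : h ∈ W
    · left
      simp only [hW, Finset.mem_insert, Finset.mem_union] at hhW
      rcases hhW with rfl | rfl | rfl | hhW | hhW
      · exact ⟨q, (sup_edge_adj _ hqt.ne).symm⟩
      · exact ⟨t, sup_edge_adj _ hqt.ne⟩
      · exact ⟨q, Or.inl (sup_edge_adj _ hvq.ne)⟩
      · exact mem_support_of_le (le_sup_left.trans le_sup_left) (hF₂S h hhW)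
      · obtain ⟨s, -, hs⟩ := hF₂Y h (Finset.mem_insert_of_mem hhW)
        exact ⟨s, Or.inl (Or.inl (mem_nbrs.1 (by rw [hs]; simp)))⟩
    · by_cases hadj : ∃ y ∈ low G H S, G.Adj y h
      · exact Or.inr hadj
      · push Not at hadj
        exact Or.inl (mem_support_of_le (hF₁₂.trans (le_sup_left.trans le_sup_left))
          (hF₁H h (mem_remote.2 ⟨hh, hhW, hadj⟩)))

/-- An auxiliary edge `p r` is replaced by paths from the star of `v` to `p` and `q t r`. -/
lemma coverable_of_swap (hC : CriticalSet G H S) (hv : Special G S v) {p q r t : V} {W : Finset V}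
    (hW : W = insert t (insert q (insert v (S ∪ low G H S))))
    (hq : q ∉ insert v (S ∪ low G H S)) (ht : t ∉ insert v (S ∪ low G H S))
    (hp : p ∉ W) (hr : r ∉ W) (hvp : G.Adj v p) (hqt : G.Adj q t) (htr : G.Adj t r)
    {F₁ : SimpleGraph V} (hF₁ : IsPacking F₁)
    (hF₁G : F₁ ≤ avoid G W ⊔ edge p r) (hpr : F₁.Adj p r)
    (hF₁H : ∀ h ∈ remote G H W (low G H S), h ∈ F₁.support) : Coverable G H := by
  have hiso : ∀ x ∈ W, x ∉ F₁.support := by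
    rintro x hx ⟨y, hy⟩
    have := hF₁G hy
    rw [sup_adj, avoid_adj, edge_adj] at this
    rcases this with h | ⟨⟨rfl, rfl⟩ | ⟨rfl, rfl⟩, -⟩
    · exact h.2.1 hx
    · exact hp hx
    · exact hr hx
  -- The stars are built in `G ⊔ edge p r`, since `F₁` uses the auxiliary edge; the swap then
  -- removes it.
  obtain ⟨F₂, hF₂G, hF₂, hF₁₂, hF₂o, hF₂Y, hF₂S⟩ := hC.exists_stars hv hF₁
    (G' := G ⊔ edge p r) le_sup_left
    (hF₁G.trans (sup_le_sup_right (avoid_le _ _) _)) (fun x hx => hiso x (by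
      rw [hW]
      exact Finset.mem_insert_of_mem (Finset.mem_insert_of_mem hx)))
  have hqF : q ∉ F₂.support := by
    rw [← nbrs_eq_empty_iff, hF₂o q hq, nbrs_eq_empty_iff]
    exact hiso q (by simp [hW])
  have htF : t ∉ F₂.support := by
    rw [← nbrs_eq_empty_iff, hF₂o t ht, nbrs_eq_empty_iff]
    exact hiso t (by simp [hW])
  obtain ⟨s₀, hs₀, hvs₀⟩ := hF₂Y v (by simp)
  have hvr : v ≠ r := by
    rintro rfl
    simp [hW] at hr
  have hF₃ := hF₂.swap (hF₁₂ hpr) (v := v) (by rw [hvs₀]; simp) hqF htF hqt.ne hvp.ne hvr (by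
    intro h
    have := mem_nbrs.2 h
    rw [hvs₀, Finset.mem_singleton] at this
    subst this
    simp [hW, hs₀] at hp)
  set D := F₂.deleteEdges {s(p, r)} with hD
  have hDG : D ≤ G := by
    intro a b hab
    rw [hD, deleteEdges_adj] at hab
    rcases hF₂G hab.1 with h | h
    · exact h
    · rw [edge_adj] at h
      exact absurd h.1 (by simpa [Sym2.eq_iff] using hab.2)
  set E := D ⊔ edge v p ⊔ edge q t ⊔ edge t r with hE
  have hsupp : ∀ x ∈ F₂.support, x ∈ E.support := by
    rintro x ⟨y, hxy⟩
    by_cases hxp : x = p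
    · subst hxp
      exact ⟨v, Or.inl (Or.inl (sup_edge_adj _ hvp.ne).symm)⟩
    by_cases hxr : x = r
    · subst hxr
      exact ⟨t, (sup_edge_adj _ htr.ne).symm⟩
    refine ⟨y, Or.inl (Or.inl (Or.inl ?_))⟩
    rw [hD, deleteEdges_adj]
    exact ⟨hxy, by simp [hxp, hxr]⟩
  refine coverable_of_attach hF₃
    (sup_edge_le (sup_edge_le (sup_edge_le hDG hvp) hqt) htr) (fun s hs => hsupp s (hF₂S s hs)) ?_ ?_
  · intro y hy
    obtain ⟨s, hs, hsy⟩ := hF₂Y y (Finset.mem_insert_of_mem hy)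
    refine ⟨s, hs, ?_⟩
    have hyW : y ∈ insert v (S ∪ low G H S) := by simp [hy]
    have hyW' : y ∈ W := by simp [hW, hy]
    have hyv : y ≠ v := by
      rintro rfl
      exact notMem_low hv hy
    have hyq : y ≠ q := fun h => hq (h ▸ hyW)
    have hyt : y ≠ t := fun h => ht (h ▸ hyW)
    have hyp : y ≠ p := fun h => hp (h ▸ hyW')
    have hyr : y ≠ r := fun h => hr (h ▸ hyW')
    rw [hE, nbrs_sup_edge_of_ne _ hyt hyr, nbrs_sup_edge_of_ne _ hyq hyt,
      nbrs_sup_edge_of_ne _ hyv hyp, ← hsy]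
    apply nbrs_congr
    intro w
    simp [hD, deleteEdges_adj, hyp, hyr]
  · intro h hh
    by_cases hhW : h ∈ W
    · left
      simp only [hW, Finset.mem_insert, Finset.mem_union] at hhW
      rcases hhW with rfl | rfl | rfl | hhW | hhW
      · exact ⟨r, sup_edge_adj _ htr.ne⟩
      · exact ⟨t, Or.inl (sup_edge_adj _ hqt.ne)⟩
      · exact hsupp _ ⟨s₀, mem_nbrs.1 (by rw [hvs₀]; simp)⟩
      · exact hsupp _ (hF₂S h hhW)
      · obtain ⟨s, -, hs⟩ := hF₂Y h (Finset.mem_insert_of_mem hhW)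
        exact hsupp _ ⟨s, mem_nbrs.1 (by rw [hs]; simp)⟩
    · by_cases hadj : ∃ y ∈ low G H S, G.Adj y h
      · exact Or.inr hadj
      · push Not at hadj
        exact Or.inl (hsupp _ (mem_support_of_le hF₁₂ (hF₁H h (mem_remote.2 ⟨hh, hhW, hadj⟩))))

lemma card_nbrs_sdiff_insert {w a : V} (hwa : G.Adj a w) (hw : w ∉ S)
    (ha : (nbrs G a \ S).card = 2) : (nbrs G a \ insert w S).card = 1 := by
  have h1 : nbrs G a \ insert w S = (nbrs G a \ S).erase w := by
    ext x
    simp only [Finset.mem_sdiff, Finset.mem_insert, Finset.mem_erase, not_or]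
    tauto
  rw [h1, Finset.card_erase_of_mem (by simp [hwa, hw]), ha]

/-- Adding a vertex with two outer neighbours of outer degree two to a critical set. -/
lemma not_special_insert (hC : CriticalSet G H S) {w a b : V} (hw : w ∉ S) (hwY : w ∉ low G H S)
    (hab : a ≠ b) (ha : G.Adj a w) (hb : G.Adj b w) (haS : a ∉ S) (hbS : b ∉ S)
    (ha2 : (nbrs G a \ S).card = 2) (hb2 : (nbrs G b \ S).card = 2) :
    ∀ u, ¬ Special G (insert w S) u := by
  refine hC.maximal _ (Finset.ssubset_insert hw) ?_
  have hcard : (insert w S).card = S.card + 1 := Finset.card_insert_of_notMem hw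
  have haY : a ∉ low G H S := fun h => by
    have := (mem_low.1 h).2.2
    omega
  have hbY : b ∉ low G H S := fun h => by
    have := (mem_low.1 h).2.2
    omega
  have hsub : insert a (insert b (low G H S)) ⊆ low G H (insert w S) := by
    intro y hy
    simp only [Finset.mem_insert] at hy
    rcases hy with rfl | rfl | hy
    · refine mem_low.2 ⟨hC.mem_of_adj _ _ ha, by simp [ha.ne, haS], ?_⟩
      rw [card_nbrs_sdiff_insert ha hw ha2]
    · refine mem_low.2 ⟨hC.mem_of_adj _ _ hb, by simp [hb.ne, hbS], ?_⟩
      rw [card_nbrs_sdiff_insert hb hw hb2]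
    · obtain ⟨h1, h2, h3⟩ := mem_low.1 hy
      refine mem_low.2 ⟨h1, ?_, (Finset.card_le_card ?_).trans h3⟩
      · simp only [Finset.mem_insert, not_or]
        exact ⟨by rintro rfl; exact hwY hy, h2⟩
      · exact Finset.sdiff_subset_sdiff subset_rfl (Finset.subset_insert _ _)
  have h1 := Finset.card_le_card hsub
  rw [Finset.card_insert_of_notMem (by simp [hab, haY]), Finset.card_insert_of_notMem hbY] at h1
  have h2 := hC.strict (insert w S) (Finset.insert_nonempty _ _)
  have h3 := hC.card_eq
  omega

/-- Two distinct such vertices would both be low for `{s}`, contradicting strictness there. -/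
lemma eq_of_adj_of_degree_two (hC : CriticalSet G H S) {s x y : V} (hx : G.Adj x s)
    (hy : G.Adj y s) (hx2 : (nbrs G x).card = 2) (hy2 : (nbrs G y).card = 2) : x = y := by
  by_contra hne
  have h1 := hC.strict {s} (Finset.singleton_nonempty s)
  have hmem : ∀ z, G.Adj z s → (nbrs G z).card = 2 → z ∈ low G H {s} := by
    intro z hz hz2
    refine mem_low.2 ⟨hC.mem_of_adj _ _ hz, by simp [hz.ne], ?_⟩
    have : (nbrs G z \ ∅).card = 2 := by simpa using hz2
    have h := card_nbrs_sdiff_insert (S := ∅) hz (by simp) this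
    simp only [insert_empty_eq] at h
    omega
  have h2 : ({x, y} : Finset V) ⊆ low G H {s} := by
    intro z hz
    simp only [Finset.mem_insert, Finset.mem_singleton] at hz
    rcases hz with rfl | rfl
    · exact hmem _ hx hx2
    · exact hmem _ hy hy2
  have h3 := Finset.card_le_card h2
  rw [Finset.card_pair hne] at h3
  simp at h1
  omega

/-- Outside `S` the triangle has no neighbours but its own vertices, so removing it costs the
remainder nothing. The path `v q p` then extends the star of `v`. -/
lemma coverable_of_triangle (hC : CriticalSet G H S) (hv : Special G S v) {p q : V}
    (hqY : q ∉ low G H S) (hpY : p ∉ low G H S)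
    (hNv : nbrs G v \ S = {p, q}) (hNq : nbrs G q \ S = {v, p}) (hNp : nbrs G p \ S = {v, q})
    (IH : ∀ (G' : SimpleGraph V) (H' : Finset V), H'.card < H.card → NoObstruction G' H' →
      Coverable G' H') : Coverable G H := by
  obtain ⟨W, hW⟩ : ∃ W, W = insert p (insert q (insert v (S ∪ low G H S))) := ⟨_, rfl⟩
  have hvq : q ∈ nbrs G v \ S := by simp [hNv]
  have hvp : p ∈ nbrs G v \ S := by simp [hNv]
  have hqp : p ∈ nbrs G q \ S := by simp [hNq]
  simp only [Finset.mem_sdiff, mem_nbrs] at hvq hvp hqp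
  have hvW : v ∈ W := by simp [hW]
  have hout : ∀ x ∈ ({v, q, p} : Finset V), ∀ y, y ∉ S → G.Adj x y → y ∈ W := by
    intro x hx y hy hxy
    have h1 : y ∈ nbrs G x \ S := by simp [hy, hxy]
    simp only [Finset.mem_insert, Finset.mem_singleton] at hx
    rcases hx with rfl | rfl | rfl
    · rw [hNv] at h1
      simp only [Finset.mem_insert, Finset.mem_singleton] at h1
      rcases h1 with rfl | rfl <;> simp [hW]
    · rw [hNq] at h1
      simp only [Finset.mem_insert, Finset.mem_singleton] at h1
      rcases h1 with rfl | rfl <;> simp [hW]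
    · rw [hNp] at h1
      simp only [Finset.mem_insert, Finset.mem_singleton] at h1
      rcases h1 with rfl | rfl <;> simp [hW]
  have hno : NoObstruction (avoid G W) (remote G H W (low G H S)) := by
    -- No exceptional vertex is needed here; `v` lies in `W` and is a dummy value.
    refine hC.noObstruction_rest hv (q := v) (W := W) ?_ not_avoid_adj subset_rfl ?_ ?_
    · rw [hW]
      exact (Finset.subset_insert _ _).trans (Finset.subset_insert _ _)
    · intro h
      exact absurd hvW (mem_remote.1 h).2.1
    · intro T hT
      right
      intro y hy _
      obtain ⟨h1, h2, h3⟩ := mem_remote.1 hy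
      apply Finset.card_le_card
      intro x hx
      simp only [Finset.mem_sdiff, mem_nbrs, Finset.mem_union, not_or] at hx
      refine Finset.mem_sdiff.2 ⟨mem_nbrs.2 ⟨hx.1, h2, fun hxW => ?_⟩, hx.2.2⟩
      have hyS : y ∉ S := fun h => h2 (by simp [hW, h])
      simp only [hW, Finset.mem_insert, Finset.mem_union] at hxW
      rcases hxW with hxW | hxW | hxW | hxW | hxW
      · exact h2 (hout x (by simp [hxW]) y hyS hx.1.symm)
      · exact h2 (hout x (by simp [hxW]) y hyS hx.1.symm)
      · exact h2 (hout x (by simp [hxW]) y hyS hx.1.symm)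
      · exact hx.2.1 hxW
      · exact h3 x hxW hx.1.symm
  obtain ⟨F₁, hF₁G, hF₁, hF₁H⟩ := IH _ _ (card_lt hv hC hvW subset_rfl) hno
  refine hC.coverable_of_chain hv hW ?_ ?_ hvq.1 hqp.1 hF₁ hF₁G hF₁H
  · simp [hvq.1.ne.symm, hvq.2, hqY]
  · simp [hvp.1.ne.symm, hvp.2, hpY]

/-- The configuration of a path `r p v q t r'` in which `v` and `q` are special while `p` and `t`
have degree two. -/
lemma coverable_of_path (hC : CriticalSet G H S) (hv : Special G S v) {p q t r r' : V}
    (hrr : r ≠ r') (hpt : p ≠ t) (hrt : r ≠ t)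
    (hpq : ¬ G.Adj p q) (hqY : ∀ y ∈ low G H S, ¬ G.Adj y q)
    (hpY : ∀ y ∈ low G H S, ¬ G.Adj y p) (htY : ∀ y ∈ low G H S, ¬ G.Adj y t)
    (hpl : p ∉ low G H S) (hql : q ∉ low G H S) (htl : t ∉ low G H S)
    (hNv : nbrs G v \ S = {p, q}) (hNq : nbrs G q \ S = {v, t})
    (hNp : nbrs G p = {v, r}) (hNt : nbrs G t = {q, r'})
    (hrS : r ∉ S) (hrS' : r' ∉ S) (hvt : v ≠ t) (hrv : r ≠ v) (hrq' : r' ≠ q)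
    (hpqne : p ≠ q)
    (IH : ∀ (G' : SimpleGraph V) (H' : Finset V), H'.card < H.card → NoObstruction G' H' →
      Coverable G' H') : Coverable G H := by
  obtain ⟨W, hW⟩ : ∃ W, W = insert t (insert q (insert v (S ∪ low G H S))) := ⟨_, rfl⟩
  have hvq : q ∈ nbrs G v \ S := by simp [hNv]
  have hvp : p ∈ nbrs G v \ S := by simp [hNv]
  have hqt : t ∈ nbrs G q \ S := by simp [hNq]
  have hpr : r ∈ nbrs G p := by simp [hNp]
  have htr : r' ∈ nbrs G t := by simp [hNt]
  simp only [Finset.mem_sdiff, mem_nbrs] at hvq hvp hqt hpr htr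
  have hvS := hv.notMem
  have hvl := notMem_low hv (H := H)
  have hvW : v ∈ W := by simp [hW]
  have hpW : p ∉ W := by simp [hW, hpt, hpqne, hvp.1.ne.symm, hvp.2, hpl]
  have hadjv : ∀ y, y ∉ S → G.Adj y v → y = p ∨ y = q := by
    intro y h1 h2
    have : y ∈ nbrs G v \ S := by simp [h1, h2.symm]
    simpa [hNv] using this
  have hadjq : ∀ y, y ∉ S → G.Adj y q → y = v ∨ y = t := by
    intro y h1 h2
    have : y ∈ nbrs G q \ S := by simp [h1, h2.symm]
    simpa [hNq] using this
  have hadjp : ∀ y, G.Adj y p → y = v ∨ y = r := by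
    intro y h2
    have := mem_nbrs.2 h2.symm
    simpa [hNp] using this
  have hadjt : ∀ y, G.Adj y t → y = q ∨ y = r' := by
    intro y h2
    have := mem_nbrs.2 h2.symm
    simpa [hNt] using this
  have hrW : r ∉ W := by
    simp only [hW, Finset.mem_insert, Finset.mem_union, not_or]
    refine ⟨hrt, ?_, hrv, hrS, fun h => hpY r h hpr.symm⟩
    rintro rfl
    exact hpq hpr
  have hrW' : r' ∉ W := by
    simp only [hW, Finset.mem_insert, Finset.mem_union, not_or]
    refine ⟨htr.ne.symm, hrq', ?_, hrS', fun h => htY r' h htr.symm⟩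
    rintro rfl
    rcases hadjv t hqt.2 htr with h | h
    · exact hpt h.symm
    · exact hqt.1.ne h.symm
  have hpr' : p ≠ r' := by
    rintro rfl
    rcases hadjp t htr with h | h
    · exact hvt h.symm
    · exact hrt h.symm
  have hnpr' : ¬ G.Adj p r' := by
    intro h
    rcases hadjp r' h.symm with h | h
    · exact hrW' (h ▸ hvW)
    · exact hrr h.symm
  have hSW : S ⊆ W := fun x hx => by simp [hW, hx]
  have hYW : low G H S ⊆ W := fun x hx => by simp [hW, hx]
  have hqW : q ∈ W := by simp [hW]
  have htW : t ∈ W := by simp [hW]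
  -- The edge `p r'` compensates `p` for the loss of `v` and `r'` for the loss of `t`.
  have hno : NoObstruction (avoid G W ⊔ edge p r') (remote G H W (low G H S)) := by
    refine hC.noObstruction_rest hv (q := p) (W := W) ?_ ?_ subset_rfl ?_ ?_
    · rw [hW]
      exact (Finset.subset_insert _ _).trans (Finset.subset_insert _ _)
    · intro w hw x hx
      rw [sup_adj, avoid_adj, edge_adj] at hx
      rcases hx with h | ⟨⟨rfl, rfl⟩ | ⟨rfl, rfl⟩, -⟩
      · exact h.2.2 hw
      · exact hrW' hw
      · exact hpW hw
    · intro _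
      have h1 : ({r, r'} : Finset V) ⊆ nbrs (avoid G W ⊔ edge p r') p := by
        intro x hx
        simp only [Finset.mem_insert, Finset.mem_singleton] at hx
        rcases hx with rfl | rfl
        · exact mem_nbrs.2 (Or.inl ⟨hpr, hpW, hrW⟩)
        · exact mem_nbrs.2 (sup_edge_adj _ hpr')
      have := Finset.card_le_card h1
      rwa [Finset.card_pair hrr] at this
    · intro T hT
      -- If `p ∈ T`, the auxiliary edge does not help `r'`. Instead `t` is added to `S ∪ T`, which
      -- makes `v` and `q` low: these two extra low vertices balance the enlarged set.
      by_cases hpT : p ∈ T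
      · left
        have htT : t ∉ S ∪ T := by
          simp only [Finset.mem_union, not_or]
          exact ⟨hqt.2, fun h => Finset.disjoint_left.1 hT h htW⟩
        have hvT : v ∉ T := fun h => Finset.disjoint_left.1 hT h hvW
        have hqT : q ∉ T := fun h => Finset.disjoint_left.1 hT h hqW
        have hdis : Disjoint S T := by
          rw [Finset.disjoint_right]
          exact fun x hx hxS => Finset.disjoint_left.1 hT hx (hSW hxS)
        have hsub : low (avoid G W ⊔ edge p r') (remote G H W (low G H S)) T ∪
            insert v (insert q (low G H S)) ⊆ low G H (insert t (S ∪ T)) := by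
          intro y hy
          simp only [Finset.mem_union, Finset.mem_insert] at hy
          rcases hy with hy | rfl | rfl | hy
          · obtain ⟨h1, h2, h3⟩ := mem_low.1 hy
            obtain ⟨h4, h5, h6⟩ := mem_remote.1 h1
            refine mem_low.2 ⟨h4, ?_, (Finset.card_le_card ?_).trans h3⟩
            · simp only [Finset.mem_insert, Finset.mem_union, not_or]
              exact ⟨fun h => h5 (h ▸ htW), fun h => h5 (hSW h), h2⟩
            · intro x hx
              simp only [Finset.mem_sdiff, mem_nbrs, Finset.mem_union, Finset.mem_insert,
                not_or] at hx
              refine Finset.mem_sdiff.2 ⟨mem_nbrs.2 (Or.inl ⟨hx.1, h5, fun hxW => ?_⟩), hx.2.2.2⟩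
              have hyS : y ∉ S := fun h => h5 (hSW h)
              simp only [hW, Finset.mem_insert, Finset.mem_union] at hxW
              rcases hxW with rfl | rfl | rfl | hxW | hxW
              · exact hx.2.1 rfl
              · rcases hadjq y hyS hx.1 with rfl | rfl
                · exact h5 hvW
                · exact h5 htW
              · rcases hadjv y hyS hx.1 with rfl | rfl
                · exact h2 hpT
                · exact h5 hqW
              · exact hx.2.2.1 hxW
              · exact h6 x hxW hx.1.symm
          · refine mem_low.2 ⟨hC.mem_of_adj _ _ hvq.1, by simp [hvt, hvS, hvT], ?_⟩
            refine (Finset.card_le_card (t := {q}) ?_).trans (by simp)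
            intro x hx
            simp only [Finset.mem_sdiff, mem_nbrs, Finset.mem_union, Finset.mem_insert,
                not_or] at hx
            rcases hadjv x hx.2.2.1 hx.1.symm with rfl | rfl
            · exact absurd hpT hx.2.2.2
            · simp
          · refine mem_low.2 ⟨hC.mem_of_adj _ _ hvq.1.symm, by simp [hqt.1.ne, hvq.2, hqT], ?_⟩
            refine (Finset.card_le_card (t := {v}) ?_).trans (by simp)
            intro x hx
            simp only [Finset.mem_sdiff, mem_nbrs, Finset.mem_union, Finset.mem_insert,
                not_or] at hx
            rcases hadjq x hx.2.2.1 hx.1.symm with rfl | rfl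
            · simp
            · exact absurd rfl hx.2.1
          · obtain ⟨h1, h2, h3⟩ := mem_low.1 hy
            refine mem_low.2 ⟨h1, ?_, (Finset.card_le_card ?_).trans h3⟩
            · simp only [Finset.mem_insert, Finset.mem_union, not_or]
              exact ⟨fun h => htl (h ▸ hy), h2,
                fun h => Finset.disjoint_left.1 hT h (hYW hy)⟩
            · exact Finset.sdiff_subset_sdiff subset_rfl
                (Finset.subset_union_left.trans (Finset.subset_insert _ _))
        have h1 := Finset.card_le_card hsub
        rw [Finset.card_union_of_disjoint, Finset.card_insert_of_notMem (by simp [hvq.1.ne, hvl]),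
          Finset.card_insert_of_notMem hql] at h1
        · have h2 := hC.strict (insert t (S ∪ T)) (Finset.insert_nonempty _ _)
          rw [Finset.card_insert_of_notMem htT, Finset.card_union_of_disjoint hdis] at h2
          have h3 := hC.card_eq
          omega
        · rw [Finset.disjoint_left]
          intro x hx hxY
          apply (mem_remote.1 (mem_low.1 hx).1).2.1
          simp only [Finset.mem_insert] at hxY
          rcases hxY with rfl | rfl | h
          · exact hvW
          · exact hqW
          · exact hYW h
      · right
        intro y hy hyp
        obtain ⟨h1, h2, h3⟩ := mem_remote.1 hy
        have hyS : y ∉ S := fun h => h2 (hSW h)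
        have hkey : ∀ x, G.Adj y x → x ∉ S → x ≠ t → x ∉ W := by
          intro x hx hxS hxt hxW
          simp only [hW, Finset.mem_insert, Finset.mem_union] at hxW
          rcases hxW with rfl | rfl | rfl | hxW | hxW
          · exact hxt rfl
          · rcases hadjq y hyS hx with rfl | rfl
            · exact h2 hvW
            · exact h2 htW
          · rcases hadjv y hyS hx with rfl | rfl
            · exact hyp rfl
            · exact h2 hqW
          · exact hxS hxW
          · exact h3 x hxW hx.symm
        -- Outside `S ∪ T`, the vertex `r'` loses `t` but gains `p`, which is not a neighbour of it
        -- in `G`.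
        by_cases hyr : y = r'
        · have hmem : p ∈ nbrs (avoid G W ⊔ edge p r') y \ T := by
            rw [Finset.mem_sdiff, mem_nbrs, hyr]
            exact ⟨(sup_edge_adj _ hpr').symm, hpT⟩
          have hsub : nbrs G y \ (S ∪ T) ⊆
              insert t ((nbrs (avoid G W ⊔ edge p r') y \ T).erase p) := by
            intro x hx
            simp only [Finset.mem_sdiff, mem_nbrs, Finset.mem_union, not_or] at hx
            by_cases hxt : x = t
            · simp [hxt]
            · refine Finset.mem_insert_of_mem (Finset.mem_erase.2 ⟨?_, Finset.mem_sdiff.2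
                ⟨mem_nbrs.2 (Or.inl ⟨hx.1, h2, hkey x hx.1 hx.2.1 hxt⟩), hx.2.2⟩⟩)
              rintro rfl
              exact hnpr' (hyr ▸ hx.1.symm)
          have h4 := Finset.card_le_card hsub
          have h5 := Finset.card_insert_le t ((nbrs (avoid G W ⊔ edge p r') y \ T).erase p)
          rw [Finset.card_erase_of_mem hmem] at h5
          have h6 := Finset.card_pos.2 ⟨p, hmem⟩
          omega
        · apply Finset.card_le_card
          intro x hx
          simp only [Finset.mem_sdiff, mem_nbrs, Finset.mem_union, not_or] at hx
          refine Finset.mem_sdiff.2 ⟨mem_nbrs.2 (Or.inl ⟨hx.1, h2, hkey x hx.1 hx.2.1 ?_⟩),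
            hx.2.2⟩
          rintro rfl
          rcases hadjt y hx.1 with rfl | rfl
          · exact h2 hqW
          · exact hyr rfl
  obtain ⟨F₁, hF₁G, hF₁, hF₁H⟩ := IH _ _ (card_lt hv hC hvW subset_rfl) hno
  have hq' : q ∉ insert v (S ∪ low G H S) := by simp [hvq.1.ne.symm, hvq.2, hql]
  have ht' : t ∉ insert v (S ∪ low G H S) := by simp [hvt.symm, hqt.2, htl]
  by_cases hpr₁ : F₁.Adj p r'
  · exact hC.coverable_of_swap hv hW hq' ht' hpW hrW' hvp.1 hqt.1 htr hF₁ hF₁G hpr₁ hF₁H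
  · refine hC.coverable_of_chain hv hW hq' ht' hvq.1 hqt.1 hF₁ ?_ hF₁H
    intro a b hab
    have := hF₁G hab
    rw [sup_adj, edge_adj] at this
    rcases this with h | ⟨⟨rfl, rfl⟩ | ⟨rfl, rfl⟩, -⟩
    · exact h
    · exact absurd hab hpr₁
    · exact absurd hab.symm hpr₁

end CriticalSet

end

/-! ### The covering theorem -/

section

variable {V : Type*}

lemma exists_pair_of_mem {A : Finset V} {a : V} (hA : A.card = 2) (ha : a ∈ A) :
    ∃ b, b ≠ a ∧ A = {a, b} := by
  obtain ⟨x, y, hxy, rfl⟩ := Finset.card_eq_two.1 hA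
  simp only [Finset.mem_insert, Finset.mem_singleton] at ha
  rcases ha with rfl | rfl
  · exact ⟨y, hxy.symm, rfl⟩
  · exact ⟨x, hxy, Finset.pair_comm _ _⟩

variable [Fintype V]

/-- If no cover exists, `coverable_of_neighbor` shows that each outer neighbour of a special vertex
is neither low nor adjacent to a low vertex and has exactly two outer neighbours. Maximality of `S`
then fixes the structure around `v` up to the two configurations already treated. -/
lemma CriticalSet.coverable {G : SimpleGraph V} {H S : Finset V} {v : V}
    (hC : CriticalSet G H S) (hv : Special G S v)
    (IH : ∀ (G' : SimpleGraph V) (H' : Finset V), H'.card < H.card → NoObstruction G' H' →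
      Coverable G' H') : Coverable G H := by
  by_contra hnot
  have hfact : ∀ w, Special G S w → ∀ b ∈ nbrs G w \ S, b ∉ low G H S ∧
      (∀ y ∈ low G H S, ¬ G.Adj y b) ∧ (nbrs G b \ S).card = 2 := by
    intro w hw b hb
    obtain ⟨a, -, hN⟩ := exists_pair_of_mem hw.card_eq hb
    rw [Finset.pair_comm] at hN
    have h1 : ¬ (b ∈ low G H S ∨ (∃ y ∈ low G H S, G.Adj y b) ∨ 3 ≤ (nbrs G b \ S).card) :=
      fun h => hnot (hC.coverable_of_neighbor hw hN h IH)
    push Not at h1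
    refine ⟨h1.1, h1.2.1, ?_⟩
    have h2 : ¬ (nbrs G b \ S).card ≤ 1 := by
      intro h
      rw [Finset.mem_sdiff, mem_nbrs] at hb
      exact h1.1 (mem_low.2 ⟨hC.mem_of_adj _ _ hb.1.symm, hb.2, h⟩)
    have h3 := h1.2.2
    omega
  have hdeg : ∀ b, (nbrs G b \ S).card = 2 → (∀ s ∈ S, ¬ G.Adj b s) →
      nbrs G b \ S = nbrs G b := by
    intro b _ h
    rw [Finset.sdiff_eq_self_iff_disjoint, Finset.disjoint_left]
    exact fun x hx hxS => h x hxS (mem_nbrs.1 hx)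
  -- If neither outer neighbour of `v` were special, both would have degree two in `G`, against
  -- strictness at `{v}`.
  obtain ⟨q, hqN, hq⟩ : ∃ q ∈ nbrs G v \ S, Special G S q := by
    by_contra hcon
    push Not at hcon
    have h2 : ∀ b ∈ nbrs G v \ S, (nbrs G b).card = 2 := by
      intro b hb
      have h3 := (hfact v hv b hb).2.2
      rw [← hdeg b h3, h3]
      intro s hs hbs
      exact hcon b hb ⟨(Finset.mem_sdiff.1 hb).2, h3, s, hs, hbs⟩
    obtain ⟨a, b, hab, hN⟩ := Finset.card_eq_two.1 hv.card_eq
    have ha : a ∈ nbrs G v \ S := by simp [hN]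
    have hb : b ∈ nbrs G v \ S := by simp [hN]
    exact hab (hC.eq_of_adj_of_degree_two (mem_nbrs.1 (Finset.mem_sdiff.1 ha).1).symm
      (mem_nbrs.1 (Finset.mem_sdiff.1 hb).1).symm (h2 a ha) (h2 b hb))
  obtain ⟨p, hpq, hNv⟩ := exists_pair_of_mem hv.card_eq hqN
  rw [Finset.pair_comm] at hNv
  have hpN : p ∈ nbrs G v \ S := by simp [hNv]
  obtain ⟨hpl, hpY, hp2⟩ := hfact v hv p hpN
  obtain ⟨hql, hqY, hq2⟩ := hfact v hv q hqN
  have hvp := hpN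
  have hvq := hqN
  simp only [Finset.mem_sdiff, mem_nbrs] at hvp hvq
  have hvS := hv.notMem
  obtain ⟨t, htv, hNq⟩ := exists_pair_of_mem hq2 (a := v) (by simp [hvq.1.symm, hvS])
  obtain ⟨r, hrv, hNp⟩ := exists_pair_of_mem hp2 (a := v) (by simp [hvp.1.symm, hvS])
  have htN : t ∈ nbrs G q \ S := by simp [hNq]
  have hrN : r ∈ nbrs G p \ S := by simp [hNp]
  obtain ⟨htl, htY, ht2⟩ := hfact q hq t htN
  have hqt := htN
  have hpr := hrN
  simp only [Finset.mem_sdiff, mem_nbrs] at hqt hpr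
  by_cases htp : t = p
  · subst htp
    have : q ∈ nbrs G t \ S := by simp [hqt.1.symm, hvq.2]
    rw [hNp] at this
    simp only [Finset.mem_insert, Finset.mem_singleton] at this
    rcases this with rfl | rfl
    · exact hvq.1.ne rfl
    · exact hnot (hC.coverable_of_triangle hv hql hpl hNv hNq hNp IH)
  have hnpq : ¬ G.Adj p q := by
    intro h
    have : p ∈ nbrs G q \ S := by simp [h.symm, hvp.2]
    rw [hNq] at this
    simp only [Finset.mem_insert, Finset.mem_singleton] at this
    rcases this with rfl | rfl
    · exact hvp.1.ne rfl
    · exact htp rfl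
  have hnvt : ¬ G.Adj v t := by
    intro h
    have : t ∈ nbrs G v \ S := by simp [h, hqt.2]
    rw [hNv] at this
    simp only [Finset.mem_insert, Finset.mem_singleton] at this
    rcases this with rfl | rfl
    · exact htp rfl
    · exact hqt.1.ne rfl
  -- With a neighbour in `S`, such an `x` would be special for `insert w S`, as it loses no outer
  -- neighbour. So all its neighbours lie outside `S`.
  have hsp : ∀ x w, x ∉ S → x ≠ w → ¬ G.Adj x w → (nbrs G x \ S).card = 2 →
      (∀ u, ¬ Special G (insert w S) u) → nbrs G x = nbrs G x \ S := by
    intro x w hxS hxw hadj hx2 hns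
    refine (hdeg x hx2 fun s hs hxs => hns x ⟨by simp [hxw, hxS], ?_, s, by simp [hs], hxs⟩).symm
    rw [Finset.sdiff_insert_of_notMem (by simpa using hadj), hx2]
  have hNt : nbrs G t = nbrs G t \ S := by
    refine hsp t v hqt.2 htv (fun h => hnvt h.symm) ht2 ?_
    exact hC.not_special_insert hvS (CriticalSet.notMem_low hv) hpq hvp.1.symm hvq.1.symm
      hvp.2 hvq.2 hp2 hq2
  have hNp' : nbrs G p = nbrs G p \ S := by
    refine hsp p q hvp.2 hpq hnpq hp2 ?_
    exact hC.not_special_insert hvq.2 hql htv.symm hvq.1 hqt.1.symm hvS hqt.2 hv.card_eq ht2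
  -- If `r = t`, adding `p` to `S` makes `v` and `t` low, yet `q` remains special for the larger
  -- set.
  have hrt : r ≠ t := by
    rintro rfl
    refine hC.not_special_insert hvp.2 hpl htv.symm hvp.1 hpr.1.symm hvS hqt.2 hv.card_eq ht2 q
      ⟨by simp [hpq.symm, hvq.2], ?_, ?_⟩
    · rw [Finset.sdiff_insert_of_notMem (by simpa using fun h => hnpq h.symm), hq2]
    · obtain ⟨s, hs, h⟩ := hq.exists_adj
      exact ⟨s, by simp [hs], h⟩
  obtain ⟨r', hrq', hNt'⟩ := exists_pair_of_mem ht2 (a := q) (by simp [hqt.1.symm, hvq.2])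
  have htr : r' ∈ nbrs G t \ S := by simp [hNt']
  simp only [Finset.mem_sdiff, mem_nbrs] at htr
  have hrr : r ≠ r' := by
    rintro rfl
    exact htp (hC.eq_of_adj_of_degree_two hpr.1 htr.1 (by rw [hNp', hp2])
      (by rw [hNt, ht2])).symm
  exact hnot (hC.coverable_of_path hv hrr (Ne.symm htp) hrt hnpq hqY hpY htY hpl hql htl hNv hNq
    (hNp'.trans hNp) (hNt.trans hNt') hpr.2 htr.2 htv.symm hrv hrq' hpq IH)

/-- Every vertex s of `H` has a neighbour of degree at least three: otherwise its neighbours, at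
least two in number, are all low for {s}, against strictness. Two applications give the edge. -/
lemma exists_adj_three_le {G : SimpleGraph V} {H : Finset V} (hno : NoObstruction G H)
    (hstrict : ∀ S : Finset V, S.Nonempty → (low G H S).card < 2 * S.card)
    (hadj : ∀ a b, G.Adj a b → a ∈ H) (hH : H.Nonempty) :
    ∃ a b, G.Adj a b ∧ 3 ≤ (nbrs G a).card ∧ 3 ≤ (nbrs G b).card := by
  have hkey : ∀ s ∈ H, ∃ x, G.Adj s x ∧ 3 ≤ (nbrs G x).card := by
    intro s hs
    by_contra hcon
    push Not at hcon
    have h1 := two_le_degree hno hs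
    have h2 : nbrs G s ⊆ low G H {s} := by
      intro x hx
      rw [mem_nbrs] at hx
      refine mem_low.2 ⟨hadj _ _ hx.symm, by simp [hx.ne.symm], ?_⟩
      have h3 := hcon x hx
      have h4 : s ∈ nbrs G x := mem_nbrs.2 hx.symm
      rw [Finset.sdiff_singleton_eq_erase, Finset.card_erase_of_mem h4]
      omega
    have h3 := Finset.card_le_card h2
    have h4 := hstrict {s} (Finset.singleton_nonempty s)
    simp at h4
    omega
  obtain ⟨h, hh⟩ := hH
  obtain ⟨x, hx, hx3⟩ := hkey h hh
  obtain ⟨y, hy, hy3⟩ := hkey x (hadj _ _ hx.symm)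
  exact ⟨x, y, hy, hx3, hy3⟩

/-- If deleting an edge between vertices of degree at least three creates an obstruction, there is
a critical set with a special vertex. -/
lemma exists_criticalSet {G : SimpleGraph V} {H : Finset V} (hno : NoObstruction G H)
    (hstrict : ∀ S : Finset V, S.Nonempty → (low G H S).card < 2 * S.card)
    (hadj : ∀ a b, G.Adj a b → a ∈ H) {a b : V} (hab : G.Adj a b) (ha : 3 ≤ (nbrs G a).card)
    (hb : 3 ≤ (nbrs G b).card) (hobs : ¬ NoObstruction (G.deleteEdges {s(a, b)}) H) :
    ∃ S v, CriticalSet G H S ∧ Special G S v := by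
  set G' := G.deleteEdges {s(a, b)} with hG'
  have hnb : ∀ y, y ≠ a → y ≠ b → nbrs G' y = nbrs G y := by
    intro y h1 h2
    apply nbrs_congr
    intro w
    simp [hG', deleteEdges_adj, h1, h2]
  have hna : nbrs G' a = (nbrs G a).erase b := by
    ext w
    simp only [hG', mem_nbrs, deleteEdges_adj, Set.mem_singleton_iff, Sym2.eq_iff,
      Finset.mem_erase]
    have := hab.ne
    constructor
    · rintro ⟨h1, h2⟩
      exact ⟨fun h => h2 (Or.inl ⟨trivial, h⟩), h1⟩
    · rintro ⟨h1, h2⟩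
      exact ⟨h2, by rintro (⟨-, h⟩ | ⟨h, -⟩); exacts [h1 h, this h]⟩
  have hnb' : nbrs G' b = (nbrs G b).erase a := by
    ext w
    simp only [hG', mem_nbrs, deleteEdges_adj, Set.mem_singleton_iff, Sym2.eq_iff,
      Finset.mem_erase]
    have := hab.ne
    constructor
    · rintro ⟨h1, h2⟩
      exact ⟨fun h => h2 (Or.inr ⟨trivial, h⟩), h1⟩
    · rintro ⟨h1, h2⟩
      exact ⟨h2, by rintro (⟨h, -⟩ | ⟨-, h⟩); exacts [this h.symm, h1 h]⟩
  have hlow : ∀ S, low G' H S ⊆ insert a (insert b (low G H S)) := by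
    intro S y hy
    simp only [Finset.mem_insert]
    by_cases hya : y = a
    · exact Or.inl hya
    by_cases hyb : y = b
    · exact Or.inr (Or.inl hyb)
    obtain ⟨h1, h2, h3⟩ := mem_low.1 hy
    rw [hnb y hya hyb] at h3
    exact Or.inr (Or.inr (mem_low.2 ⟨h1, h2, h3⟩))
  have hlow0 : low G H ∅ = ∅ := by
    have := hno ∅
    simpa using this
  unfold NoObstruction at hobs
  push Not at hobs
  obtain ⟨S, hS⟩ := hobs
  have hSne : S.Nonempty := by
    rw [Finset.nonempty_iff_ne_empty]
    rintro rfl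
    obtain ⟨y, hy⟩ : (low G' H ∅).Nonempty := Finset.card_pos.1 (by simpa using hS)
    have h3 := (mem_low.1 hy).2.2
    rw [Finset.sdiff_empty] at h3
    have h1 := hlow ∅ hy
    simp only [hlow0, Finset.mem_insert, Finset.notMem_empty, or_false] at h1
    rcases h1 with rfl | rfl
    · rw [hna] at h3
      have := Finset.pred_card_le_card_erase (a := b) (s := nbrs G y)
      omega
    · rw [hnb'] at h3
      have := Finset.pred_card_le_card_erase (a := a) (s := nbrs G y)
      omega
  have hst := hstrict S hSne
  have hlowa : low G' H S ⊆ insert a (insert b (low G H S)) := hlow S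
  -- Only `a` and `b` can become low, while the count rises from below 2|S| to above it. So both
  -- become low and `S` was exactly one short.
  have hcard : (low G H S).card + 1 = 2 * S.card := by
    have h1 := Finset.card_le_card hlowa
    have h2 := Finset.card_insert_le a (insert b (low G H S))
    have h3 := Finset.card_insert_le b (low G H S)
    omega
  have haG : a ∈ low G' H S ∧ a ∉ low G H S := by
    by_contra hcon
    have h1 : low G' H S ⊆ insert b (low G H S) := by
      intro y hy
      rcases Finset.mem_insert.1 (hlowa hy) with rfl | h
      · by_cases h2 : y ∈ low G H S
        · exact Finset.mem_insert_of_mem h2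
        · exact absurd ⟨hy, h2⟩ hcon
      · exact h
    have h2 := Finset.card_le_card h1
    have h3 := Finset.card_insert_le b (low G H S)
    omega
  have hspec : Special G S a := by
    obtain ⟨h1, h2, h3⟩ := mem_low.1 haG.1
    have h4 : ¬ (nbrs G a \ S).card ≤ 1 := fun h => haG.2 (mem_low.2 ⟨h1, h2, h⟩)
    have h5 : nbrs G' a \ S = (nbrs G a \ S).erase b := by
      rw [hna, Finset.erase_sdiff_comm]
    rw [h5] at h3
    have h6 := Finset.pred_card_le_card_erase (a := b) (s := nbrs G a \ S)
    refine ⟨h2, by omega, ?_⟩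
    by_contra hcon
    push Not at hcon
    have h7 : nbrs G a \ S = nbrs G a := by
      rw [Finset.sdiff_eq_self_iff_disjoint, Finset.disjoint_left]
      exact fun x hx hxS => hcon x hxS (mem_nbrs.1 hx)
    rw [h7] at h6 h3
    omega
  -- Having a special vertex is part of the property being maximised, so larger sets one short of
  -- equality have none.
  obtain ⟨T, ⟨hT1, v, hv⟩, hTmax⟩ := (Set.toFinite {T : Finset V |
    (low G H T).card + 1 = 2 * T.card ∧ ∃ v, Special G T v}).exists_maximal ⟨S, hcard, a, hspec⟩
  refine ⟨T, v, ⟨hno, hstrict, hadj, hT1, ?_⟩, hv⟩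
  intro U hTU hU w hw
  exact hTU.2 (hTmax (y := U) ⟨hU, w, hw⟩ hTU.1)

lemma ncard_edgeSet_deleteEdge_lt {G : SimpleGraph V} {a b : V} (h : G.Adj a b) :
    (G.deleteEdges {s(a, b)}).edgeSet.ncard < G.edgeSet.ncard := by
  apply Set.ncard_lt_ncard _ (Set.toFinite _)
  rw [edgeSet_deleteEdges]
  refine ⟨Set.sdiff_subset, fun hsub => ?_⟩
  have := hsub ((mem_edgeSet G).2 h)
  simp at this

/-- If there is no obstruction, the vertices in `H` can be covered. -/
theorem NoObstruction.coverable (n m : ℕ) : ∀ (G : SimpleGraph V) (H : Finset V), H.card = n →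
    G.edgeSet.ncard = m → NoObstruction G H → Coverable G H := by
  induction n using Nat.strong_induction_on generalizing m with
  | _ n ihn =>
  induction m using Nat.strong_induction_on with
  | _ m ihm =>
  intro G H hHn hGm hno
  have IH : ∀ (G' : SimpleGraph V) (H' : Finset V), H'.card < H.card → NoObstruction G' H' →
      Coverable G' H' := fun G' H' h1 h2 => ihn H'.card (hHn ▸ h1) _ G' H' rfl rfl h2
  have IHe : ∀ a b, G.Adj a b → NoObstruction (G.deleteEdges {s(a, b)}) H → Coverable G H :=
    fun a b hab h => (ihm _ (hGm ▸ ncard_edgeSet_deleteEdge_lt hab) _ H hHn rfl h).mono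
      (G.deleteEdges_le _)
  rcases H.eq_empty_or_nonempty with rfl | hH
  · exact ⟨⊥, bot_le, isPacking_bot, by simp⟩
  by_cases htight : ∃ S : Finset V, S.Nonempty ∧ (low G H S).card = 2 * S.card
  · obtain ⟨S, hS, hcard⟩ := htight
    exact coverable_of_tight hno hS hcard IH
  have hstrict : ∀ S : Finset V, S.Nonempty → (low G H S).card < 2 * S.card :=
    fun S hS => lt_of_le_of_ne (hno S) fun h => htight ⟨S, hS, h⟩
  by_cases hdel : ∃ a b, G.Adj a b ∧ a ∉ H ∧ (b ∉ H ∨ 3 ≤ (nbrs G b).card)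
  · obtain ⟨a, b, hab, ha, hb⟩ := hdel
    exact IHe a b hab (noObstruction_deleteEdge hno hstrict ha hb)
  push Not at hdel
  have hdeg : ∀ a b, G.Adj a b → a ∉ H → b ∈ H ∧ (nbrs G b).card = 2 := by
    intro a b hab ha
    obtain ⟨h1, h2⟩ := hdel a b hab ha
    have := two_le_degree hno h1
    exact ⟨h1, by omega⟩
  by_cases hleaf : ∃ v b, G.Adj v b ∧ v ∉ H
  · obtain ⟨v, b, hvb, hv⟩ := hleaf
    obtain ⟨hb, hb2⟩ := hdeg v b hvb hv
    obtain ⟨c, hcv, hNb⟩ := exists_pair_of_mem hb2 (mem_nbrs.2 hvb.symm)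
    refine coverable_of_leaf hstrict hv hb hcv.symm hNb ?_ IH
    -- All neighbours of `v` have degree two, hence are low for `{v}`; strictness permits only one.
    have h1 : nbrs G v ⊆ low G H {v} := by
      intro x hx
      rw [mem_nbrs] at hx
      obtain ⟨h1, h2⟩ := hdeg v x hx hv
      refine mem_low.2 ⟨h1, by simp [hx.ne.symm], ?_⟩
      rw [Finset.sdiff_singleton_eq_erase, Finset.card_erase_of_mem (mem_nbrs.2 hx.symm), h2]
    have h2 := Finset.card_le_card h1
    have h3 := hstrict {v} (Finset.singleton_nonempty v)
    rw [Finset.card_singleton] at h3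
    refine (Finset.eq_of_subset_of_card_le ?_ ?_).symm
    · simpa using hvb
    · rw [Finset.card_singleton]
      omega
  push Not at hleaf
  obtain ⟨a, b, hab, ha, hb⟩ := exists_adj_three_le hno hstrict hleaf hH
  by_cases hobs : NoObstruction (G.deleteEdges {s(a, b)}) H
  · exact IHe a b hab hobs
  · obtain ⟨S, v, hC, hv⟩ := exists_criticalSet hno hstrict hleaf hab ha hb hobs
    exact hC.coverable hv IH

end

/-! ### Vertices of large degree, and reduced packings as unions of short paths -/

section

variable {V : Type*}

lemma exists_embedding_of_adj_iff {F : SimpleGraph V} {n : ℕ} (u : Fin (n + 1) → V)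
    (hu : Function.Injective u)
    (h : ∀ i w, F.Adj (u i) w ↔ ∃ j, (pathGraph (n + 1)).Adj i j ∧ w = u j) :
    ∃ f : pathGraph (n + 1) ↪g F, (∀ i, f i = u i) ∧
      ∀ i w, F.Adj (f i) w → w ∈ Set.range f := by
  refine ⟨⟨⟨u, hu⟩, ?_⟩, fun _ => rfl, ?_⟩
  · intro i j
    change F.Adj (u i) (u j) ↔ _
    rw [h]
    constructor
    · rintro ⟨k, hk, hjk⟩
      rwa [hu hjk]
    · exact fun hij => ⟨j, hij, rfl⟩
  · intro i w hw
    obtain ⟨j, -, rfl⟩ := (h i w).1 hw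
    exact ⟨j, rfl⟩

/-- A connected graph embedded as a closed set of vertices is a component. -/
lemma nonempty_iso_of_embedding {U W : Type*} {K : SimpleGraph U} (hK : K.Preconnected)
    {H : SimpleGraph W} (f : K ↪g H) (hf : ∀ i w, H.Adj (f i) w → w ∈ Set.range f) (i : U) :
    Nonempty ((H.connectedComponentMk (f i)).toSimpleGraph ≃g K) := by
  have hmem : ∀ j, f j ∈ (H.connectedComponentMk (f i)).supp := by
    intro j
    rw [ConnectedComponent.mem_supp_iff, ConnectedComponent.eq]
    exact (hK j i).map f.toHom
  have hrange : ∀ x y, H.Reachable x y → x ∈ Set.range f → y ∈ Set.range f := by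
    rintro x y ⟨p⟩
    induction p with
    | nil => exact id
    | cons h _ ih =>
      rintro ⟨j, rfl⟩
      exact ih (hf j _ h)
  let g : U → (H.connectedComponentMk (f i)).supp := fun j => ⟨f j, hmem j⟩
  have hg : Function.Bijective g := by
    constructor
    · intro a b hab
      exact f.injective (congrArg Subtype.val hab)
    · rintro ⟨y, hy⟩
      rw [ConnectedComponent.mem_supp_iff, ConnectedComponent.eq] at hy
      obtain ⟨j, rfl⟩ := hrange _ _ hy.symm ⟨i, rfl⟩
      exact ⟨j, rfl⟩
  refine ⟨(RelIso.symm ⟨Equiv.ofBijective g hg, ?_⟩)⟩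
  intro a b
  exact f.map_rel_iff

/-- A graph of maximum degree one. -/
lemma isolatedVerticesOrEdges_of_forall {W : Type*} {H : SimpleGraph W}
    (h : ∀ a b c, H.Adj a b → H.Adj a c → b = c) : H.IsolatedVerticesOrEdges := by
  intro C
  induction C using ConnectedComponent.ind with
  | h v =>
  by_cases hv : ∃ w, H.Adj v w
  · right
    obtain ⟨w, hw⟩ := hv
    let f : completeGraph (Fin 2) ↪g H := ⟨⟨![v, w], by
      intro i j hij
      have := hw.ne
      fin_cases i <;> fin_cases j <;> simp_all⟩, by
      intro i j
      change H.Adj (![v, w] i) (![v, w] j) ↔ _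
      have := hw.symm
      fin_cases i <;> fin_cases j <;> simp_all⟩
    refine nonempty_iso_of_embedding (f := f) (i := 0) ?_ ?_
    · exact preconnected_top
    · intro i x hx
      fin_cases i
      · exact ⟨1, h v w x hw hx⟩
      · exact ⟨0, h w v x hw.symm hx⟩
  · left
    let f : completeGraph (Fin 1) ↪g H := ⟨⟨fun _ => v, fun i j _ => Subsingleton.elim i j⟩, by
      intro i j
      simp [Subsingleton.elim i j]⟩
    refine nonempty_iso_of_embedding (f := f) (i := 0) ?_ ?_
    · exact preconnected_top
    · intro i x hx
      exact absurd ⟨x, hx⟩ hv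

variable [Fintype V]

/-- The vertices of large degree admit no obstruction. -/
lemma noObstruction_of_degree {G : SimpleGraph V} {d : ℕ} (hd : ∀ v, (nbrs G v).card ≤ d) :
    NoObstruction G (Finset.univ.filter fun v => d + 2 ≤ 2 * (nbrs G v).card) := by
  intro S
  set Y := low G (Finset.univ.filter fun v => d + 2 ≤ 2 * (nbrs G v).card) S with hY
  rcases Y.eq_empty_or_nonempty with h | ⟨y₀, hy₀⟩
  · simp [h]
  have hYd : ∀ y ∈ Y, d + 2 ≤ 2 * (nbrs G y).card ∧ (nbrs G y \ S).card ≤ 1 := by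
    intro y hy
    obtain ⟨h1, -, h3⟩ := mem_low.1 hy
    exact ⟨(Finset.mem_filter.1 h1).2, h3⟩
  have hdpos : 0 < d := by
    have h1 := (hYd y₀ hy₀).1
    have h2 := hd y₀
    omega
  -- Each vertex of `Y` sends at least (d+2)/2 − 1 = d/2 edges to `S`, and each vertex of `S`
  -- receives at most `d`.
  have hcount := Finset.sum_card_bipartiteAbove_eq_sum_card_bipartiteBelow (s := Y) (t := S) G.Adj
  have h1 : d * Y.card ≤ 2 * ∑ y ∈ Y, (S.bipartiteAbove G.Adj y).card := by
    rw [Finset.mul_sum, mul_comm, ← smul_eq_mul]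
    apply Finset.card_nsmul_le_sum
    intro y hy
    obtain ⟨h2, h3⟩ := hYd y hy
    have h4 := Finset.card_sdiff_add_card_inter (nbrs G y) S
    have h5 : nbrs G y ∩ S = S.bipartiteAbove G.Adj y := by
      ext x
      simp [Finset.bipartiteAbove, and_comm]
    rw [h5] at h4
    omega
  have h2 : ∑ s ∈ S, (Y.bipartiteBelow G.Adj s).card ≤ S.card * d := by
    rw [← smul_eq_mul]
    apply Finset.sum_le_card_nsmul
    intro s _
    refine (Finset.card_le_card ?_).trans (hd s)
    intro x hx
    rw [Finset.mem_bipartiteBelow] at hx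
    exact mem_nbrs.2 hx.2.symm
  rw [hcount] at h1
  have h3 : d * Y.card ≤ d * (2 * S.card) := by nlinarith
  exact Nat.le_of_mul_le_mul_left h3 hdpos

/-- In an edge-minimal packing, one of the two neighbours of an inner edge is a leaf. -/
def IsReduced (F : SimpleGraph V) : Prop :=
  ∀ a b, F.Adj a b → (nbrs F a).card = 2 → (nbrs F b).card = 2 →
    (∃ x, x ≠ b ∧ F.Adj a x ∧ (nbrs F x).card = 1) ∨ ∃ x, x ≠ a ∧ F.Adj b x ∧ (nbrs F x).card = 1

/-- Take an edge-minimal packing with no smaller support. If an edge joins two vertices of degree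
two, neither of which has another neighbour that is a leaf, deleting it uncovers nothing and leaves
no single-edge component. -/
lemma IsPacking.exists_reduced {F : SimpleGraph V} (hF : IsPacking F) :
    ∃ F' ≤ F, IsPacking F' ∧ IsReduced F' ∧ F.support ⊆ F'.support := by
  obtain ⟨F', hle, ⟨⟨h1, h2⟩, hmin⟩⟩ := (Set.toFinite {F' : SimpleGraph V |
    IsPacking F' ∧ F.support ⊆ F'.support}).exists_le_minimal (a := F) ⟨hF, subset_rfl⟩
  refine ⟨F', hle, h1, ?_, h2⟩
  intro a b hab ha hb
  by_contra hcon
  push Not at hcon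
  have hpos : ∀ x y, F'.Adj x y → (nbrs F' y).card ≠ 1 → (nbrs F' y).card = 2 := by
    intro x y hxy hne
    have h3 := h1.card_le_two y
    have h4 := Finset.card_pos.2 ⟨x, mem_nbrs.2 hxy.symm⟩
    omega
  set D := F'.deleteEdges {s(a, b)} with hD
  have hDF : D ≤ F' := F'.deleteEdges_le _
  have hDo : ∀ x, x ≠ a → x ≠ b → nbrs D x = nbrs F' x := by
    intro x h1 h2
    apply nbrs_congr
    intro w
    simp [hD, deleteEdges_adj, h1, h2]
  have hDadj : ∀ x y, F'.Adj x y → s(x, y) ≠ s(a, b) → D.Adj x y := by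
    intro x y h3 h4
    rw [hD, deleteEdges_adj]
    exact ⟨h3, h4⟩
  have hdel : ∀ x y, D.Adj x y → s(x, y) ≠ s(a, b) := by
    intro x y h
    rw [hD, deleteEdges_adj] at h
    exact h.2
  have hother : ∀ x y, D.Adj x y → (x = a ∨ x = b) → (nbrs D y).card = 2 := by
    intro x y hxy hx
    have h3 := hdel x y hxy
    have hxy' := hDF hxy
    rcases hx with rfl | rfl
    · have hyb : y ≠ b := by rintro rfl; exact h3 rfl
      rw [hDo y hxy'.ne.symm hyb]
      exact hpos _ _ hxy' (hcon.1 y hyb hxy')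
    · have hya : y ≠ a := by rintro rfl; exact h3 Sym2.eq_swap
      rw [hDo y hya hxy'.ne.symm]
      exact hpos _ _ hxy' (hcon.2 y hya hxy')
  have hmem : D ∈ {F' : SimpleGraph V | IsPacking F' ∧ F.support ⊆ F'.support} := by
    refine ⟨⟨fun x => (Finset.card_le_card (nbrs_mono hDF x)).trans (h1.card_le_two x), ?_⟩, ?_⟩
    · intro x y hxy
      by_cases hx : x = a ∨ x = b
      · exact Or.inr (hother x y hxy hx)
      by_cases hy : y = a ∨ y = b
      · exact Or.inl (hother y x hxy.symm hy)
      push Not at hx hy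
      rw [hDo x hx.1 hx.2, hDo y hy.1 hy.2]
      exact h1.card_eq_two x y (hDF hxy)
    · intro x hx
      have hx' := h2 hx
      by_cases hxa : x = a
      · subst hxa
        obtain ⟨y, hyb, hy⟩ := exists_pair_of_mem ha (mem_nbrs.2 hab)
        refine ⟨y, hDadj x y (mem_nbrs.1 (hy ▸ by simp)) ?_⟩
        simp [hyb, hab.ne]
      by_cases hxb : x = b
      · subst hxb
        obtain ⟨y, hya, hy⟩ := exists_pair_of_mem hb (mem_nbrs.2 hab.symm)
        refine ⟨y, hDadj x y (mem_nbrs.1 (hy ▸ by simp)) ?_⟩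
        simp [hya, hab.ne.symm]
      · obtain ⟨y, hy⟩ := hx'
        refine ⟨y, hDadj x y hy ?_⟩
        simp [hxa, hxb]
  exact hdel a b (hmin hmem hDF hab) rfl

/-- The component of `F - c` containing the neighbour `a` of `c` has at most two vertices. -/
def ShortBranch (F : SimpleGraph V) (a c : V) : Prop :=
  nbrs F a = {c} ∨ ∃ x, x ≠ c ∧ nbrs F a = {c, x} ∧ nbrs F x = {a}

/-- The two branches at `c` are short. -/
def IsCenter (F : SimpleGraph V) (c : V) : Prop :=
  (nbrs F c).card = 2 ∧ ∀ a, F.Adj c a → ShortBranch F a c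

lemma nbrs_eq_singleton {F : SimpleGraph V} {a c : V} (h : F.Adj a c)
    (h1 : (nbrs F a).card = 1) : nbrs F a = {c} := by
  obtain ⟨x, hx⟩ := Finset.card_eq_one.1 h1
  have := mem_nbrs.2 h
  rw [hx, Finset.mem_singleton] at this
  rw [hx, this]

lemma shortBranch_of_adj {F : SimpleGraph V} {a c x : V} (hF : IsPacking F) (hac : F.Adj a c)
    (hxc : x ≠ c) (hax : F.Adj a x) (hx : (nbrs F x).card = 1) : ShortBranch F a c := by
  right
  refine ⟨x, hxc, ?_, nbrs_eq_singleton hax.symm hx⟩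
  symm
  apply Finset.eq_of_subset_of_card_le
  · intro y hy
    simp only [Finset.mem_insert, Finset.mem_singleton] at hy
    rcases hy with rfl | rfl <;> simpa
  · rw [Finset.card_pair hxc.symm]
    exact hF.card_le_two a

lemma card_nbrs_of_adj {F : SimpleGraph V} (hF : IsPacking F) {a b : V} (h : F.Adj a b) :
    (nbrs F b).card = 1 ∨ (nbrs F b).card = 2 := by
  have h3 := hF.card_le_two b
  have h4 := Finset.card_pos.2 ⟨a, mem_nbrs.2 h.symm⟩
  omega

/-- Let z be the other neighbour of `y`. If the branch from `y` through z is short, `y` is the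
center. Otherwise z is: a further neighbour a of z has degree two, and reducedness of the edge za
yields a leaf next to a, since one next to z would make the branch short. -/
lemma exists_center_of_leaf {F : SimpleGraph V} (hF : IsPacking F) (hR : IsReduced F) {x y : V}
    (hxy : F.Adj x y) (hx : (nbrs F x).card = 1) :
    ∃ c, IsCenter F c ∧ (y = c ∨ F.Adj c y) := by
  have hy : (nbrs F y).card = 2 := (hF.card_eq_two x y hxy).resolve_left (by omega)
  obtain ⟨z, hzx, hNy⟩ := exists_pair_of_mem hy (mem_nbrs.2 hxy.symm)
  have hyz : F.Adj y z := mem_nbrs.1 (hNy ▸ by simp)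
  by_cases hz : ShortBranch F z y
  · refine ⟨y, ⟨hy, fun a ha => ?_⟩, Or.inl rfl⟩
    have := mem_nbrs.2 ha
    rw [hNy, Finset.mem_insert, Finset.mem_singleton] at this
    rcases this with rfl | rfl
    · exact Or.inl (nbrs_eq_singleton hxy hx)
    · exact hz
  · have hz2 : (nbrs F z).card = 2 := (card_nbrs_of_adj hF hyz).resolve_left
      fun h => hz (Or.inl (nbrs_eq_singleton hyz.symm h))
    refine ⟨z, ⟨hz2, fun a ha => ?_⟩, Or.inr hyz.symm⟩
    by_cases hay : a = y
    · subst hay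
      exact shortBranch_of_adj hF hyz hzx.symm hxy.symm hx
    · rcases card_nbrs_of_adj hF ha with h1 | h2
      · exact absurd (shortBranch_of_adj hF hyz.symm hay ha h1) hz
      · rcases hR z a ha hz2 h2 with ⟨w, hwa, hzw, hw⟩ | ⟨w, hwz, haw, hw⟩
        · have hwy : w ≠ y := by
            rintro rfl
            omega
          exact absurd (shortBranch_of_adj hF hyz.symm hwy hzw hw) hz
        · exact shortBranch_of_adj hF ha.symm hwz haw hw

/-- If `x` has degree two and a branch that is not short, reducedness of the first edge of that
branch produces a leaf adjacent to `x`, which reduces to the case of a leaf. In particular cycles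
cannot occur. -/
lemma exists_center {F : SimpleGraph V} (hF : IsPacking F) (hR : IsReduced F) {x : V}
    (hx : x ∈ F.support) :
    ∃ c, IsCenter F c ∧ (x = c ∨ F.Adj c x ∨ ∃ a, F.Adj c a ∧ F.Adj a x) := by
  obtain ⟨y, hxy⟩ := hx
  rcases card_nbrs_of_adj hF hxy.symm with h1 | h2
  · obtain ⟨c, hc, h⟩ := exists_center_of_leaf hF hR hxy h1
    refine ⟨c, hc, ?_⟩
    rcases h with rfl | h
    · exact Or.inr (Or.inl hxy.symm)
    · exact Or.inr (Or.inr ⟨y, h, hxy.symm⟩)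
  · by_cases hall : ∀ a, F.Adj x a → ShortBranch F a x
    · exact ⟨x, ⟨h2, hall⟩, Or.inl rfl⟩
    · push Not at hall
      obtain ⟨a, ha, hna⟩ := hall
      have ha2 : (nbrs F a).card = 2 := (card_nbrs_of_adj hF ha).resolve_left
        fun h => hna (Or.inl (nbrs_eq_singleton ha.symm h))
      rcases hR x a ha h2 ha2 with ⟨w, hwa, hxw, hw⟩ | ⟨w, hwx, haw, hw⟩
      · obtain ⟨c, hc, h⟩ := exists_center_of_leaf hF hR hxw.symm hw
        exact ⟨c, hc, h.imp_right Or.inl⟩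
      · exact absurd (shortBranch_of_adj hF ha.symm hwx haw hw) hna

lemma exists_embedding_two {F : SimpleGraph V} {a c b : V} (hab : a ≠ b) (hNc : nbrs F c = {a, b})
    (hNa : nbrs F a = {c}) (hNb : nbrs F b = {c}) :
    ∃ f : pathGraph (2 + 1) ↪g F, c ∈ Set.range f ∧ ∀ i w, F.Adj (f i) w → w ∈ Set.range f := by
  have hca : c ≠ a := (mem_nbrs.1 (hNc ▸ by simp : a ∈ nbrs F c)).ne
  have hcb : c ≠ b := (mem_nbrs.1 (hNc ▸ by simp : b ∈ nbrs F c)).ne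
  obtain ⟨f, hf, hcl⟩ := exists_embedding_of_adj_iff (F := F) (n := 2) ![a, c, b]
    (by
      intro i j h
      fin_cases i <;> fin_cases j <;> simp_all)
    (by
      intro i w
      rw [← mem_nbrs]
      fin_cases i <;> simp [hNa, hNb, hNc, pathGraph_adj, Fin.exists_fin_succ, or_comm])
  exact ⟨f, ⟨1, hf 1⟩, hcl⟩

lemma exists_embedding_three {F : SimpleGraph V} {a c b y : V} (hab : a ≠ b) (hyc : y ≠ c)
    (hNc : nbrs F c = {a, b}) (hNa : nbrs F a = {c}) (hNb : nbrs F b = {c, y})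
    (hNy : nbrs F y = {b}) :
    ∃ f : pathGraph (3 + 1) ↪g F, c ∈ Set.range f ∧ ∀ i w, F.Adj (f i) w → w ∈ Set.range f := by
  have hca : c ≠ a := (mem_nbrs.1 (hNc ▸ by simp : a ∈ nbrs F c)).ne
  have hcb : c ≠ b := (mem_nbrs.1 (hNc ▸ by simp : b ∈ nbrs F c)).ne
  have hby : b ≠ y := (mem_nbrs.1 (hNb ▸ by simp : y ∈ nbrs F b)).ne
  have hay : a ≠ y := by
    rintro rfl
    rw [hNa, Finset.singleton_inj] at hNy
    exact hcb hNy
  obtain ⟨f, hf, hcl⟩ := exists_embedding_of_adj_iff (F := F) (n := 3) ![a, c, b, y]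
    (by
      intro i j h
      fin_cases i <;> fin_cases j <;> simp_all)
    (by
      intro i w
      rw [← mem_nbrs]
      fin_cases i <;> simp [hNa, hNb, hNc, hNy, pathGraph_adj, Fin.exists_fin_succ, or_comm])
  exact ⟨f, ⟨1, hf 1⟩, hcl⟩

lemma exists_embedding_four {F : SimpleGraph V} {x a c b y : V} (hab : a ≠ b) (hxc : x ≠ c)
    (hyc : y ≠ c) (hNc : nbrs F c = {a, b}) (hNa : nbrs F a = {c, x}) (hNx : nbrs F x = {a})
    (hNb : nbrs F b = {c, y}) (hNy : nbrs F y = {b}) :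
    ∃ f : pathGraph (4 + 1) ↪g F, c ∈ Set.range f ∧ ∀ i w, F.Adj (f i) w → w ∈ Set.range f := by
  have hca : c ≠ a := (mem_nbrs.1 (hNc ▸ by simp : a ∈ nbrs F c)).ne
  have hcb : c ≠ b := (mem_nbrs.1 (hNc ▸ by simp : b ∈ nbrs F c)).ne
  have hby : b ≠ y := (mem_nbrs.1 (hNb ▸ by simp : y ∈ nbrs F b)).ne
  have hax : a ≠ x := (mem_nbrs.1 (hNa ▸ by simp : x ∈ nbrs F a)).ne
  have hay : a ≠ y := by
    rintro rfl
    have : c ∈ nbrs F a := by simp [hNa]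
    rw [hNy, Finset.mem_singleton] at this
    exact hcb this
  have hbx : b ≠ x := by
    rintro rfl
    have : c ∈ nbrs F b := by simp [hNb]
    rw [hNx, Finset.mem_singleton] at this
    exact hca this
  have hxy : x ≠ y := by
    rintro rfl
    rw [hNx, Finset.singleton_inj] at hNy
    exact hab hNy
  obtain ⟨f, hf, hcl⟩ := exists_embedding_of_adj_iff (F := F) (n := 4) ![x, a, c, b, y]
    (by
      intro i j h
      fin_cases i <;> fin_cases j <;> simp_all)
    (by
      intro i w
      rw [← mem_nbrs]
      fin_cases i <;> simp [hNa, hNb, hNc, hNx, hNy, pathGraph_adj, Fin.exists_fin_succ, or_comm])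
  exact ⟨f, ⟨2, hf 2⟩, hcl⟩

/-- The component of a center is a path. -/
lemma IsCenter.exists_embedding {F : SimpleGraph V} {c : V} (hc : IsCenter F c) :
    ∃ n : ℕ, (n = 2 ∨ n = 3 ∨ n = 4) ∧ ∃ f : pathGraph (n + 1) ↪g F,
      c ∈ Set.range f ∧ ∀ i w, F.Adj (f i) w → w ∈ Set.range f := by
  obtain ⟨hc2, hbr⟩ := hc
  obtain ⟨a, b, hab, hNc⟩ := Finset.card_eq_two.1 hc2
  have hca : F.Adj c a := mem_nbrs.1 (hNc ▸ by simp)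
  have hcb : F.Adj c b := mem_nbrs.1 (hNc ▸ by simp)
  rcases hbr a hca with ha | ⟨x, hxc, ha, hx⟩ <;> rcases hbr b hcb with hb | ⟨y, hyc, hb, hy⟩
  · exact ⟨2, by simp, exists_embedding_two hab hNc ha hb⟩
  · exact ⟨3, by simp, exists_embedding_three hab hyc hNc ha hb hy⟩
  · exact ⟨3, by simp, exists_embedding_three hab.symm hxc (by rw [hNc, Finset.pair_comm]) hb ha hx⟩
  · exact ⟨4, by simp, exists_embedding_four hab hxc hyc hNc ha hx hb hy⟩

lemma IsPacking.exists_path_embedding {F : SimpleGraph V} (hF : IsPacking F) (hR : IsReduced F)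
    {x : V} (hx : x ∈ F.support) :
    ∃ n : ℕ, (n = 2 ∨ n = 3 ∨ n = 4) ∧ ∃ f : pathGraph (n + 1) ↪g F,
      x ∈ Set.range f ∧ ∀ i w, F.Adj (f i) w → w ∈ Set.range f := by
  obtain ⟨c, hc, hxc⟩ := exists_center hF hR hx
  obtain ⟨n, hn, f, ⟨i, hi⟩, hf⟩ := hc.exists_embedding
  refine ⟨n, hn, f, ?_, hf⟩
  rcases hxc with rfl | h | ⟨a, hca, hax⟩
  · exact ⟨i, hi⟩
  · exact hf i x (hi ▸ h)
  · obtain ⟨j, rfl⟩ := hf i a (hi ▸ hca)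
    exact hf j x hax

end

/-! ### Maximal packings and the main theorem -/

section

variable {V : Type*} [Fintype V]

/-- A reduced packing covering `H` whose set of covered vertices is maximal. -/
lemma Coverable.exists_maximal {G : SimpleGraph V} {H : Finset V} (h : Coverable G H) :
    ∃ F ≤ G, IsPacking F ∧ IsReduced F ∧ (∀ v ∈ H, v ∈ F.support) ∧
      ∀ F' ≤ G, IsPacking F' → F.support ⊆ F'.support → F'.support ⊆ F.support := by
  obtain ⟨F₀, h1, h2, h3⟩ := h
  obtain ⟨F, ⟨hFG, hF, hFH⟩, hmax⟩ := Set.exists_max_image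
    {F : SimpleGraph V | F ≤ G ∧ IsPacking F ∧ ∀ v ∈ H, v ∈ F.support}
    (fun F => F.support.ncard) (Set.toFinite _) ⟨F₀, h1, h2, h3⟩
  -- Reduction keeps every vertex covered, so the maximality of the support is inherited.
  obtain ⟨F', hle, hF', hR, hsub⟩ := hF.exists_reduced
  refine ⟨F', hle.trans hFG, hF', hR, fun v hv => hsub (hFH v hv), ?_⟩
  intro E hEG hE hF'E
  have h4 := hmax E ⟨hEG, hE, fun v hv => hF'E (hsub (hFH v hv))⟩
  have h5 := Set.eq_of_subset_of_ncard_le (hsub.trans hF'E) h4 (Set.toFinite _)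
  rwa [← h5]

/-- A subgraph on its support. -/
def supportSubgraph {F G : SimpleGraph V} (h : F ≤ G) : G.Subgraph where
  verts := F.support
  Adj := F.Adj
  adj_sub hab := h hab
  edge_vert {_ w} hab := ⟨w, hab⟩
  symm := ⟨fun _ _ hab => hab.symm⟩

lemma supportSubgraph_component {F G : SimpleGraph V} (h : F ≤ G) (hF : IsPacking F)
    (hR : IsReduced F) (C : (supportSubgraph h).coe.ConnectedComponent) :
    ∃ n : ℕ, (n = 2 ∨ n = 3 ∨ n = 4) ∧ C.toSimpleGraph.IsPathOfLength n := by
  induction C using ConnectedComponent.ind with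
  | h x =>
  obtain ⟨n, hn, f, ⟨i, hi⟩, hf⟩ := hF.exists_path_embedding hR x.2
  have hsupp : ∀ j, f j ∈ F.support := by
    intro j
    -- As n ≥ 2, the path is connected on more than one vertex, so each of its vertices has a
    -- neighbour and lies in the support.
    have hne : ∃ k, (pathGraph (n + 1)).Adj j k := by
      have : Nontrivial (Fin (n + 1)) := Fin.nontrivial_iff_two_le.2 (by omega)
      exact (pathGraph_preconnected (n + 1)).exists_adj_of_nontrivial j
    obtain ⟨k, hk⟩ := hne
    exact ⟨f k, f.map_rel_iff.2 hk⟩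
  let g : pathGraph (n + 1) ↪g (supportSubgraph h).coe :=
    ⟨⟨fun j => ⟨f j, hsupp j⟩, fun a b hab => f.injective (congrArg Subtype.val hab)⟩,
      fun {a b} => f.map_rel_iff⟩
  have hgi : g i = x := Subtype.ext hi
  refine ⟨n, hn, ?_⟩
  rw [← hgi]
  refine nonempty_iso_of_embedding (pathGraph_preconnected _) g ?_ i
  intro j w hw
  obtain ⟨k, hk⟩ := hf j w.1 hw
  exact ⟨k, Subtype.ext hk⟩

end

end PathPacking

open PathPacking in
theorem mainTheorem3 {V : Type*} [Fintype V] (G : SimpleGraph V) [DecidableRel G.Adj] :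
    ∃ F : G.Subgraph,
      F.coe.IsLinearForest ∧
      (∀ C : F.coe.ConnectedComponent,
        ∃ n : ℕ, (n = 2 ∨ n = 3 ∨ n = 4) ∧ C.toSimpleGraph.IsPathOfLength n) ∧
      (G.induce (F.vertsᶜ)).IsolatedVerticesOrEdges ∧
      (∀ v : V, v ∉ F.verts → (G.degree v : ℝ) ≤ ((G.maxDegree : ℝ) + 1) / 2) ∧
      (∀ v : V, v ∉ F.verts → ∀ u : V, u ∈ F.verts → G.Adj v u → F.degree u = 2) := by
  have hdeg : ∀ v, (nbrs G v).card = G.degree v := by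
    intro v
    rw [← G.card_neighborFinset_eq_degree]
    congr 1
    ext w
    simp
  obtain ⟨F, hFG, hF, hR, hH, hmax⟩ := (NoObstruction.coverable _ _ G _ rfl rfl
    (noObstruction_of_degree (d := G.maxDegree) fun v => by
      rw [hdeg]
      exact G.degree_le_maxDegree v)).exists_maximal
  have hcomp := supportSubgraph_component hFG hF hR
  refine ⟨supportSubgraph hFG, fun C => ?_, hcomp, ?_, ?_, ?_⟩
  · obtain ⟨n, -, hn⟩ := hcomp C
    exact ⟨n, hn⟩
  · refine isolatedVerticesOrEdges_of_forall ?_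
    rintro ⟨a, ha⟩ ⟨b, hb⟩ ⟨c, hc⟩ hab hac
    by_contra hbc
    have hbc' : b ≠ c := fun h => hbc (Subtype.ext h)
    have hab' : G.Adj a b := hab
    have hac' : G.Adj a c := hac
    refine hb (hmax (F ⊔ SimpleGraph.edge b a ⊔ SimpleGraph.edge a c) (sup_edge_le (sup_edge_le hFG hab'.symm) hac')
      (hF.addPath hab'.ne.symm hac'.ne hbc' hb ha hc)
      (fun v hv => mem_support_of_le (le_sup_left.trans le_sup_left) hv) ?_)
    exact ⟨a, Or.inl (sup_edge_adj _ hab'.ne.symm)⟩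
  · intro v hv
    have h1 : ¬ G.maxDegree + 2 ≤ 2 * G.degree v := by
      intro h
      exact hv (hH v (by rw [Finset.mem_filter, hdeg]; exact ⟨Finset.mem_univ _, h⟩))
    have h2 : 2 * G.degree v ≤ G.maxDegree + 1 := by omega
    have h3 : (2 : ℝ) * G.degree v ≤ G.maxDegree + 1 := by exact_mod_cast h2
    linarith
  · intro v hv u hu hvu
    have h1 : (nbrs F u).card = 2 := by
      obtain ⟨w, hw⟩ : u ∈ F.support := hu
      refine (card_nbrs_of_adj hF (SimpleGraph.Adj.symm hw)).resolve_left fun h => ?_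
      refine hv (hmax (F ⊔ SimpleGraph.edge u v) (sup_edge_le hFG hvu.symm) (hF.addPendant hv h)
        (fun v hv => mem_support_of_le le_sup_left hv) ?_)
      exact ⟨u, (sup_edge_adj _ hvu.ne.symm).symm⟩
    rw [← h1, ← SimpleGraph.Subgraph.finset_card_neighborSet_eq_degree]
    congr 1
    ext w
    rw [Set.mem_toFinset, mem_nbrs]
    rfl
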